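/- **Setting.** An *obstacle* is a non-empty bounded domain (connected open set) $D\subset\mathbb R^3$ with Lipschitz boundary and connected exterior $\mathbb R^3\setminus\overline D$. Let $\nu$ be the outward unit normal on $\partial D$ and $ds$ the surface measure. For $\hat x,d,p\in\mathbb S^2$ and $k>0$ let $H^i(y)=(d\times p)\,e^{ik\,y\cdot d}$ be the incident magnetic plane wave. In the physical optics (Kirchhoff) approximation for a perfect conductor, $\nu\times H_{po}=2\,\nu\times H^i$ on the illuminated part $\{y\in\partial D:\nu(y)\cdot d<0\}$ and $\nu\times H_{po}=0$ on the shadow part $\{y\in\partial D:\nu(y)\cdot d\ge 0\}$, and the electric far field pattern is $$E^\infty_{po}(\hat x,d,p,k)=ik\,\hat x\times\int_{\partial D}\big[(\nu\times H_{po})(y)\times\hat x\big]\,e^{-ik\hat x\cdot y}\,ds(y)=2ik\,\hat x\times\int_{\{\nu\cdot d<0\}}\big[\nu(y)\times(d\times p)\big]\times\hat x\;e^{ik(d-\hat x)\cdot y}\,ds(y)\in\mathbb C^3 .$$ For $\theta\in\mathbb S^2$ let $S_D(\theta)=\{y\in\mathbb R^3:\inf_{z\in D}z\cdot\theta\le y\cdot\theta\le\sup_{z\in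 D}z\cdot\theta\}$, the smallest strip with normals $\pm\theta$ containing $\overline D$. **Theorem.** Let $K=[k_{\min},k_{\max}]$ with $0<k_{\min}<k_{\max}$, and let $d,p,\hat x\in\mathbb S^2$ satisfy $$A(\hat x,d,p):=\hat x\times\big([(d-\hat x)\times(d\times p)]\times\hat x\big)\ne 0 .$$ Put $\phi=(d-\hat x)/|d-\hat x|$. Let $D_1,D_2$ be obstacles; in the exceptional case where $d\times\hat x\neq0$ and $p$ lies in the plane spanned by $d$ and $\hat x$, assume also that, for $j=1,2$, the grazing set $\{y\in\partial D_j:\nu(y)\cdot d=0\}$ has surface measure zero. If $D_1$ and $D_2$ have the same far field patterns $E^\infty_{po}(\hat x,d,p,k)$ and $E^\infty_{po}(-\hat x,-d,p,k)$ for all $k\in K$, then $S_{D_1}(\phi)=S_{D_2}(\phi)$. -/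

import Mathlib

open MeasureTheory
open scoped RealInnerProductSpace Matrix

/-- Euclidean space `ℝ³`. -/
abbrev E3 : Type := EuclideanSpace ℝ (Fin 3)

/-- The space `ℂ³` of complex vectors, with its Euclidean norm. -/
abbrev C3 : Type := EuclideanSpace ℂ (Fin 3)

noncomputable section

namespace PhysicalOptics

/-- The cross product of vectors in `R³`, used for `R = ℝ` and for `R = ℂ` (where it is bilinear,
without complex conjugation). -/
def cross {R : Type*} [CommRing R] (a b : EuclideanSpace R (Fin 3)) : EuclideanSpace R (Fin 3) :=
  WithLp.toLp 2 (crossProduct (WithLp.ofLp a) (WithLp.ofLp b))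

/-- A real vector regarded as a complex vector. -/
def toC (a : E3) : C3 := WithLp.toLp 2 fun i => (a i : ℂ)

/-- `D` has a Lipschitz boundary: near every boundary point there is a Cartesian coordinate system
in which `D` is the region strictly above the graph of a Lipschitz function of two variables. -/
def HasLipschitzBoundary (D : Set E3) : Prop :=
  ∀ x ∈ frontier D, ∃ (b : OrthonormalBasis (Fin 3) ℝ E3) (L : NNReal)
    (γ : EuclideanSpace ℝ (Fin 2) → ℝ) (U : Set E3),
    LipschitzWith L γ ∧ IsOpen U ∧ x ∈ U ∧
      ∀ y ∈ U, y ∈ D ↔ γ !₂[⟪b 0, y⟫, ⟪b 1, y⟫] < ⟪b 2, y⟫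

/-- Obstacles: bounded (non-empty) domains with Lipschitz boundary and connected exterior. -/
structure IsObstacle (D : Set E3) : Prop where
  isOpen : IsOpen D
  isConnected : IsConnected D
  isBounded : Bornology.IsBounded D
  lipschitz : HasLipschitzBoundary D
  exterior_connected : IsConnected (closure D)ᶜ

/-- `ν` is a unit outward normal to `∂D` at `x`: to first order at `x`, the set `D` is the
half-space `{y | (y - x) · ν < 0}`. -/
def IsOutwardNormal (D : Set E3) (x ν : E3) : Prop :=
  ‖ν‖ = 1 ∧ ∀ ε > 0, ∃ r > 0, ∀ y ∈ Metric.ball x r,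
    (⟪y - x, ν⟫ < -(ε * ‖y - x‖) → y ∈ D) ∧ (ε * ‖y - x‖ < ⟪y - x, ν⟫ → y ∉ D)

/-- There is at most one unit outward normal at a point. -/
theorem IsOutwardNormal.unique {D : Set E3} {x ν ν' : E3}
    (h : IsOutwardNormal D x ν) (h' : IsOutwardNormal D x ν') : ν = ν' := by
  by_contra hne
  obtain ⟨hn, h⟩ := h
  obtain ⟨hn', h'⟩ := h'
  have hw : 0 < ‖ν' - ν‖ := norm_pos_iff.2 (sub_ne_zero.2 (Ne.symm hne))
  set n := ‖ν' - ν‖ with hn0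
  have hsq : n * n = 2 - 2 * ⟪ν', ν⟫ := by
    rw [hn0, ← real_inner_self_eq_norm_mul_norm, inner_sub_left, inner_sub_right, inner_sub_right,
      real_inner_self_eq_norm_mul_norm, real_inner_self_eq_norm_mul_norm, hn, hn',
      real_inner_comm ν' ν]
    ring
  obtain ⟨r, hr, H⟩ := h (n / 4) (by positivity)
  obtain ⟨r', hr', H'⟩ := h' (n / 4) (by positivity)
  obtain ⟨t, ht0, ht⟩ : ∃ t > 0, t * n < min r r' := by
    refine ⟨min r r' / (2 * n), by positivity, ?_⟩
    have : min r r' / (2 * n) * n = min r r' / 2 := by field_simp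
    rw [this]
    have : 0 < min r r' := by positivity
    linarith
  have hyx : x + t • (ν' - ν) - x = t • (ν' - ν) := by abel
  have hnorm : ‖x + t • (ν' - ν) - x‖ = t * n := by
    rw [hyx, norm_smul, Real.norm_of_nonneg ht0.le]
  have htn : 0 < t * (n * n) := by positivity
  have i1 : ⟪x + t • (ν' - ν) - x, ν⟫ = -(t * (n * n) / 2) := by
    rw [hyx, real_inner_smul_left, inner_sub_left, real_inner_self_eq_norm_mul_norm, hn, hsq]
    ring
  have i2 : ⟪x + t • (ν' - ν) - x, ν'⟫ = t * (n * n) / 2 := by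
    rw [hyx, real_inner_smul_left, inner_sub_left, real_inner_self_eq_norm_mul_norm, hn', hsq,
      real_inner_comm ν' ν]
    ring
  refine (H' (x + t • (ν' - ν)) ?_).2 ?_ ((H (x + t • (ν' - ν)) ?_).1 ?_)
  · rw [mem_ball_iff_norm, hnorm]; exact ht.trans_le (min_le_right _ _)
  · rw [i2, hnorm]; nlinarith
  · rw [mem_ball_iff_norm, hnorm]; exact ht.trans_le (min_le_left _ _)
  · rw [i1, hnorm]; nlinarith

open Classical in
/-- The outward unit normal field `ν` on `∂D`. For a Lipschitz boundary it exists at almost every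
point of `∂D` with respect to surface measure; where it does not exist it is set to `0`. -/
def normal (D : Set E3) (x : E3) : E3 :=
  if h : ∃ ν, IsOutwardNormal D x ν then h.choose else 0

/-- The surface measure `ds` on `∂D`: two-dimensional Hausdorff measure, normalized so that it is
Lebesgue measure on planes. -/
def surfaceMeasure (D : Set E3) : Measure E3 := (μHE[2] : Measure E3).restrict (frontier D)

/-- The magnetic field `Hⁱ(y) = (d × p) e^{ik y·d}` of the incident plane wave. -/
def incidentH (d p : E3) (k : ℝ) (y : E3) : C3 :=
  Complex.exp (Complex.I * k * ⟪y, d⟫) • toC (cross d p)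

/-- The surface field `ν × H` in the physical optics (Kirchhoff) approximation: it is `2 ν × Hⁱ`
on the illuminated part `ν · d < 0` of the boundary and `0` on the shadow part `ν · d ≥ 0`. -/
def poField (D : Set E3) (d p : E3) (k : ℝ) (y : E3) : C3 :=
  if ⟪normal D y, d⟫ < 0 then (2 : ℂ) • cross (toC (normal D y)) (incidentH d p k y) else 0

/-- The electric far field pattern in the physical optics approximation,
`E^∞_po(x, d, p, k) = ik x × ∫_{∂D} [(ν × H_po)(y) × x] e^{-ik x·y} ds(y)`. -/
def farField (D : Set E3) (x d p : E3) (k : ℝ) : C3 :=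
  (Complex.I * k) • cross (toC x)
    (∫ y, Complex.exp (-(Complex.I * k * ⟪x, y⟫)) • cross (poField D d p k y) (toC x)
      ∂(surfaceMeasure D))

/-- `A(x, d, p) = x × ([(d - x) × (d × p)] × x)`. -/
def amplitude (x d p : E3) : E3 :=
  cross x (cross (cross (d - x) (cross d p)) x)

/-- The direction `φ = (d - x) / |d - x|`. -/
def stripNormal (x d : E3) : E3 := ‖d - x‖⁻¹ • (d - x)

/-- The strip hull of `D` in the direction `θ`. -/
def strip (D : Set E3) (θ : E3) : Set E3 :=
  {y | sInf ((fun z : E3 => ⟪z, θ⟫) '' D) ≤ ⟪y, θ⟫ ∧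
    ⟪y, θ⟫ ≤ sSup ((fun z : E3 => ⟪z, θ⟫) '' D)}

/-- The grazing set `{y ∈ ∂D | ν(y) · d = 0}` has surface measure zero. Equivalently, the shadow
part of `∂D` for the direction `d` is, up to a null set, the illuminated part for `-d`. -/
def GrazingNull (D : Set E3) (d : E3) : Prop :=
  surfaceMeasure D {y | ⟪normal D y, d⟫ = 0} = 0

end PhysicalOptics

end

open PhysicalOptics

/-! Write w = d - x and B(n) = x × ([n × (d × p)] × x), which is linear in n, with B(w) = A. The far
field is 2ik times the integral of e^{ik w·y} B(ν) over the illuminated part of ∂D. Reversing x and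
d turns w into -w, B into -B, and the illuminated part into {ν·d > 0}. Adding the conjugate of the
second pattern to the first therefore gives 2ik times the integral of e^{ik w·y} B(ν) over ∂D
without the grazing set. The divergence theorem evaluates the integral over all of ∂D as ik A ∫_D
e^{ik w·y} dy, so the data determine -2k² A ∫_D e^{ik w·y} dy (`sum_mul_farField_add_conj`).

The grazing set must not matter. In the exceptional case it is null by hypothesis. Otherwise only
the component along a suitable c is used, with c·A ≠ 0 and c·B(n) = 0 for every n orthogonal to d
(`exists_direction`).

As D is bounded, ∫_D e^{ik w·y} dy is entire in k. Its values on K thus determine the image of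
volume on D under y ↦ w·y (`map_inner_eq_of_integral_planeWave_eq`). As D is open, every open set of
reals that meets the projection of D has positive mass, so the infimum and supremum of the
projection can be read off (`strip_eq_of_map_inner_eq`).

Most of the work is the divergence theorem for Lipschitz boundaries, with Hausdorff surface measure
and pointwise normals (`integral_fderiv_eq_integral_normal`). It rests on Rademacher's theorem, the
area formula for graphs (`comap_graphMap`), the theorem for epigraphs (`integral_epigraph_fderiv`)
and a partition of unity. -/

noncomputable section
namespace PhysicalOptics

/-! ### Orthonormal coordinates and graphs. -/

/-- The Euclidean plane. -/
abbrev E2 : Type := EuclideanSpace ℝ (Fin 2)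

/-- The first two coordinates with respect to an orthonormal basis of `ℝ³`. -/
def chartProj (b : OrthonormalBasis (Fin 3) ℝ E3) : E3 →L[ℝ] E2 :=
  LinearMap.toContinuousLinearMap
    { toFun := fun y => !₂[⟪b 0, y⟫, ⟪b 1, y⟫]
      map_add' := fun x y => by ext i; fin_cases i <;> simp [inner_add_right]
      map_smul' := fun c y => by ext i; fin_cases i <;> simp [inner_smul_right] }

/-- The embedding of the plane as the span of the first two vectors of an orthonormal basis. -/
def chartEmb (b : OrthonormalBasis (Fin 3) ℝ E3) : E2 →L[ℝ] E3 :=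
  LinearMap.toContinuousLinearMap
    { toFun := fun z => z 0 • b 0 + z 1 • b 1
      map_add' := fun x y => by simp only [PiLp.add_apply, add_smul]; abel
      map_smul' := fun c y => by simp [smul_smul] }

variable (b : OrthonormalBasis (Fin 3) ℝ E3)

theorem chartProj_apply (y : E3) : chartProj b y = !₂[⟪b 0, y⟫, ⟪b 1, y⟫] := rfl

theorem chartEmb_apply (z : E2) : chartEmb b z = z 0 • b 0 + z 1 • b 1 := rfl

@[simp] theorem chartProj_chartEmb (z : E2) : chartProj b (chartEmb b z) = z := by
  ext i
  fin_cases i <;> simp [chartProj_apply, chartEmb_apply, inner_add_right, inner_smul_right]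

@[simp] theorem chartProj_normal : chartProj b (b 2) = 0 := by
  ext i
  fin_cases i <;> simp [chartProj_apply]

@[simp] theorem inner_normal_chartEmb (z : E2) : ⟪b 2, chartEmb b z⟫ = 0 := by
  simp [chartEmb_apply, inner_add_right, inner_smul_right]

theorem inner_normal_self : ⟪b 2, b 2⟫ = 1 := by simp

theorem chartEmb_chartProj_add (y : E3) :
    chartEmb b (chartProj b y) + ⟪b 2, y⟫ • b 2 = y := by
  conv_rhs => rw [← b.sum_repr y]
  simp [Fin.sum_univ_three, chartEmb_apply, chartProj_apply, b.repr_apply_apply]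

theorem inner_chartEmb (z : E2) (y : E3) : ⟪chartEmb b z, y⟫ = ⟪z, chartProj b y⟫ := by
  simp [chartEmb_apply, chartProj_apply, inner_add_left, inner_smul_left, PiLp.inner_apply,
    Fin.sum_univ_two, mul_comm]

theorem norm_sq_chart (z : E2) (t : ℝ) :
    ‖chartEmb b z + t • b 2‖ ^ 2 = ‖z‖ ^ 2 + t ^ 2 := by
  rw [← real_inner_self_eq_norm_sq, ← real_inner_self_eq_norm_sq]
  simp only [inner_add_left, inner_add_right, inner_chartEmb, chartProj_chartEmb, inner_smul_left,
    inner_smul_right, chartProj_normal, inner_normal_chartEmb, inner_normal_self]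
  simp; ring

theorem norm_le_norm_chart (z : E2) (t : ℝ) : ‖z‖ ≤ ‖chartEmb b z + t • b 2‖ := by
  have := norm_sq_chart b z t
  exact abs_le_of_sq_le_sq' (by nlinarith [sq_nonneg t]) (norm_nonneg _) |>.2

theorem norm_chart_le (z : E2) (t : ℝ) : ‖chartEmb b z + t • b 2‖ ≤ ‖z‖ + |t| := by
  have := norm_sq_chart b z t
  refine abs_le_of_sq_le_sq' ?_ (by positivity) |>.2
  nlinarith [sq_abs t, norm_nonneg z, abs_nonneg t, mul_nonneg (norm_nonneg z) (abs_nonneg t)]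

/-- Cartesian coordinates on `ℝ³` adapted to an orthonormal basis, as an isometry. -/
def chartIsometry : WithLp 2 (E2 × ℝ) ≃ₗᵢ[ℝ] E3 where
  toFun q := chartEmb b q.fst + q.snd • b 2
  invFun y := WithLp.toLp 2 (chartProj b y, ⟪b 2, y⟫)
  map_add' q r := by simp only [WithLp.add_fst, WithLp.add_snd, map_add, add_smul]; abel
  map_smul' c q := by simp [smul_smul]
  left_inv q := by
    apply (WithLp.equiv 2 (E2 × ℝ)).injective
    ext1 <;> simp [inner_add_right, inner_smul_right]
  right_inv y := chartEmb_chartProj_add b y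
  norm_map' q := by
    have h := norm_sq_chart b q.fst q.snd
    have h' := WithLp.prod_norm_sq_eq_of_L2 q
    rw [Real.norm_eq_abs, sq_abs, ← h] at h'
    exact (sq_eq_sq₀ (norm_nonneg _) (norm_nonneg _)).1 h'.symm

theorem measurePreserving_chart :
    MeasurePreserving (fun q : E2 × ℝ => chartEmb b q.1 + q.2 • b 2) volume volume := by
  have h1 := (chartIsometry b).measurePreserving
  have h2 := WithLp.volume_preserving_toLp E2 ℝ
  exact h1.comp h2

/-- The graph of a function of two variables, in the coordinates given by an orthonormal basis. -/
def graphMap (γ : E2 → ℝ) (z : E2) : E3 := chartEmb b z + γ z • b 2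

@[simp] theorem chartProj_graphMap (γ : E2 → ℝ) (z : E2) : chartProj b (graphMap b γ z) = z := by
  simp [graphMap]

@[simp] theorem inner_normal_graphMap (γ : E2 → ℝ) (z : E2) : ⟪b 2, graphMap b γ z⟫ = γ z := by
  simp [graphMap, inner_add_right, inner_smul_right]

theorem mem_range_graphMap (γ : E2 → ℝ) (y : E3) :
    y ∈ Set.range (graphMap b γ) ↔ ⟪b 2, y⟫ = γ (chartProj b y) := by
  constructor
  · rintro ⟨z, rfl⟩; simp
  · intro h
    refine ⟨chartProj b y, ?_⟩
    rw [graphMap, ← h, chartEmb_chartProj_add]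

theorem graphMap_injective (γ : E2 → ℝ) : Function.Injective (graphMap b γ) := fun z w h => by
  simpa using congrArg (chartProj b) h

variable {b} {γ : E2 → ℝ}

theorem continuous_graphMap (hγ : Continuous γ) : Continuous (graphMap b γ) := by
  unfold graphMap; fun_prop

theorem measurableEmbedding_graphMap (hγ : Continuous γ) : MeasurableEmbedding (graphMap b γ) :=
  (continuous_graphMap hγ).measurableEmbedding (graphMap_injective b γ)

theorem lipschitzWith_graphMap {L : NNReal} (hγ : LipschitzWith L γ) (t : ℝ) :
    LipschitzWith (1 + L) (graphMap b fun z => γ z + t) := by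
  refine LipschitzWith.of_dist_le_mul fun z w => ?_
  have : graphMap b (fun z => γ z + t) z - graphMap b (fun z => γ z + t) w =
      chartEmb b (z - w) + (γ z - γ w) • b 2 := by
    simp only [graphMap, map_sub, add_smul, sub_smul]; abel
  rw [dist_eq_norm, this, dist_eq_norm]
  refine (norm_chart_le b _ _).trans ?_
  have := hγ.dist_le_mul z w
  rw [Real.dist_eq, dist_eq_norm] at this
  push_cast
  linarith

end PhysicalOptics
end

/-! ### The area formula for Lipschitz graphs. -/

noncomputable section
namespace PhysicalOptics

open Filter Topology Module
open scoped ENNReal NNReal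

/-- If `f` expands distances at most `c` times as much as `g` does on `s`, then the images of `s`
have `μHE[d] (f '' s) ≤ c ^ d * μHE[d] (g '' s)`. -/
theorem euclideanHausdorffMeasure_image_le_of_dist_le {X Y Z : Type*} [MetricSpace Y]
    [MeasurableSpace Y] [BorelSpace Y] [MetricSpace Z] [MeasurableSpace Z] [BorelSpace Z]
    {f : X → Y} {g : X → Z} {s : Set X} {c : ℝ≥0} (d : ℕ)
    (h : ∀ x ∈ s, ∀ y ∈ s, dist (f x) (f y) ≤ c * dist (g x) (g y)) :
    (μHE[d] : Measure Y) (f '' s) ≤ (c : ℝ≥0∞) ^ d * (μHE[d] : Measure Z) (g '' s) := by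
  classical
  rcases s.eq_empty_or_nonempty with rfl | ⟨x₀, hx₀⟩
  · simp
  have : Nonempty X := ⟨x₀⟩
  have hinv : ∀ x ∈ s, Function.invFunOn g s (g x) ∈ s ∧ g (Function.invFunOn g s (g x)) = g x :=
    fun x hx => ⟨Function.invFunOn_mem ⟨x, hx, rfl⟩, Function.invFunOn_eq ⟨x, hx, rfl⟩⟩
  -- The hypothesis makes f constant on the fibres of g in s, so the choice of preimage is harmless
  -- and f ∘ g⁻¹ is a c-Lipschitz map.
  have himg : (fun w => f (Function.invFunOn g s w)) '' (g '' s) = f '' s := by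
    rw [Set.image_image]
    refine Set.image_congr fun x hx => ?_
    have := h _ (hinv x hx).1 x hx
    rw [(hinv x hx).2, dist_self, mul_zero] at this
    exact dist_le_zero.1 this
  have hlip : LipschitzOnWith c (fun w => f (Function.invFunOn g s w)) (g '' s) := by
    refine LipschitzOnWith.of_dist_le_mul ?_
    rintro _ ⟨x, hx, rfl⟩ _ ⟨y, hy, rfl⟩
    have := h _ (hinv x hx).1 _ (hinv y hy).1
    rwa [(hinv x hx).2, (hinv y hy).2] at this
  have hle := hlip.hausdorffMeasure_image_le (d := d) (Nat.cast_nonneg d)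
  rw [himg, ENNReal.rpow_natCast] at hle
  simp only [Measure.euclideanHausdorffMeasure_def, Measure.smul_apply]
  rw [ENNReal.smul_def, ENNReal.smul_def, smul_eq_mul, smul_eq_mul, mul_left_comm]
  gcongr

/-- The derivative of `graphMap` at a point where the function has derivative `a`. -/
def graphDeriv (b : OrthonormalBasis (Fin 3) ℝ E3) (a : E2 →L[ℝ] ℝ) : E2 →L[ℝ] E3 :=
  chartEmb b + a.smulRight (b 2)

theorem graphDeriv_apply (b : OrthonormalBasis (Fin 3) ℝ E3) (a : E2 →L[ℝ] ℝ) (z : E2) :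
    graphDeriv b a z = chartEmb b z + a z • b 2 := rfl

theorem hasFDerivAt_graphMap {b : OrthonormalBasis (Fin 3) ℝ E3} {γ : E2 → ℝ} {a : E2 →L[ℝ] ℝ}
    {z : E2} (h : HasFDerivAt γ a z) : HasFDerivAt (graphMap b γ) (graphDeriv b a) z :=
  (chartEmb b).hasFDerivAt.add (h.smul_const (b 2))

theorem norm_sq_dual (a : E2 →L[ℝ] ℝ) :
    ‖a‖ ^ 2 = a (EuclideanSpace.single 0 1) ^ 2 + a (EuclideanSpace.single 1 1) ^ 2 := by
  have h : ∀ i, ((InnerProductSpace.toDual ℝ E2).symm a) i = a (EuclideanSpace.single i 1) := by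
    intro i
    have := InnerProductSpace.toDual_symm_apply (𝕜 := ℝ) (x := EuclideanSpace.single i (1 : ℝ))
      (y := a)
    rw [← this, EuclideanSpace.inner_single_right]
    simp
  rw [← LinearIsometryEquiv.norm_map (InnerProductSpace.toDual ℝ E2).symm a,
    EuclideanSpace.norm_sq_eq, Fin.sum_univ_two, h, h]
  simp

/-- The surface element of a graph with derivative `a`. -/
def graphJacobian (a : E2 →L[ℝ] ℝ) : ℝ := √(1 + ‖a‖ ^ 2)

theorem graphJacobian_pos (a : E2 →L[ℝ] ℝ) : 0 < graphJacobian a := by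
  unfold graphJacobian; positivity

theorem graphJacobian_sq (a : E2 →L[ℝ] ℝ) : graphJacobian a ^ 2 = 1 + ‖a‖ ^ 2 :=
  Real.sq_sqrt (by positivity)

theorem continuous_graphJacobian : Continuous graphJacobian := by
  unfold graphJacobian; fun_prop

/-- The Gram matrix of the derivative is I + a aᵀ, with determinant 1 + ‖a‖². -/
theorem normDet_graphDeriv (b : OrthonormalBasis (Fin 3) ℝ E3) (a : E2 →L[ℝ] ℝ) :
    (graphDeriv b a : E2 →ₗ[ℝ] E3).normDet = graphJacobian a := by
  have h := (graphDeriv b a : E2 →ₗ[ℝ] E3).normDet_sq_eq_det_gram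
    (EuclideanSpace.basisFun (Fin 2) ℝ)
  rw [← sq_eq_sq₀ (LinearMap.normDet_nonneg _) (graphJacobian_pos a).le, graphJacobian_sq,
    norm_sq_dual]
  have hin : ∀ z w : E2, ⟪graphDeriv b a z, graphDeriv b a w⟫ = ⟪z, w⟫ + a z * a w := by
    intro z w
    simp only [graphDeriv_apply, inner_add_left, inner_add_right, inner_chartEmb,
      chartProj_chartEmb, inner_smul_left, inner_smul_right, chartProj_normal,
      inner_normal_chartEmb, inner_normal_self]
    simp; ring
  simp only [Matrix.det_fin_two, Matrix.gram_apply, ContinuousLinearMap.coe_coe, hin,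
    EuclideanSpace.basisFun_apply] at h
  simp only [RCLike.ofReal_real_eq_id, id] at h
  rw [h]
  simp [EuclideanSpace.inner_single_left]
  ring

/-- With α = ‖a'‖, this is 1 + (α + δ)² ≤ (1 + δ)²(1 + α²); the difference is 2δ(1 - α + α²) + δ²α².
-/
theorem graphJacobian_le {a a' : E2 →L[ℝ] ℝ} {δ : ℝ} (hδ : 0 ≤ δ) (h : ‖a - a'‖ ≤ δ) :
    graphJacobian a ≤ (1 + δ) * graphJacobian a' := by
  refine abs_le_of_sq_le_sq' ?_ (mul_nonneg (by linarith) (graphJacobian_pos a').le) |>.2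
  rw [mul_pow, graphJacobian_sq, graphJacobian_sq]
  have h1 : ‖a‖ ≤ ‖a'‖ + δ := by
    have := norm_sub_norm_le a a'
    linarith
  have h2 : ‖a‖ ^ 2 ≤ (‖a'‖ + δ) ^ 2 := pow_le_pow_left₀ (norm_nonneg _) h1 2
  have h3 := mul_nonneg hδ (sq_nonneg (‖a'‖ - 1))
  have h4 := mul_nonneg hδ (norm_nonneg a')
  nlinarith [mul_nonneg (sq_nonneg δ) (sq_nonneg ‖a'‖)]

theorem volume_image_graphDeriv (b : OrthonormalBasis (Fin 3) ℝ E3) (a : E2 →L[ℝ] ℝ) (s : Set E2) :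
    (μHE[2] : Measure E3) (graphDeriv b a '' s) = ENNReal.ofReal (graphJacobian a) * volume s := by
  have h := (graphDeriv b a : E2 →ₗ[ℝ] E3).euclideanHausdorffMeasure_image_eq_normDet_mul_volume s
  rw [normDet_graphDeriv, finrank_euclideanSpace_fin] at h
  exact h

/-- Making the cover disjoint turns a local inequality of measures into a global one. -/
theorem measure_le_mul_of_cover {α ι : Type*} [MeasurableSpace α] [Countable ι] {μ ν : Measure α}
    {T : ι → Set α} {c : ℝ≥0∞} (hT : ∀ i, MeasurableSet (T i)) (h0 : μ (⋃ i, T i)ᶜ = 0)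
    (h : ∀ i, ∀ t ⊆ T i, MeasurableSet t → μ t ≤ c * ν t) {s : Set α} (hs : MeasurableSet s) :
    μ s ≤ c * ν s := by
  rcases isEmpty_or_nonempty ι with hι | hι
  · have : μ s = 0 := measure_mono_null (by simp) h0
    simp [this]
  obtain ⟨e, he⟩ := exists_surjective_nat ι
  have hU : ⋃ n, T (e n) = ⋃ i, T i := he.iUnion_comp T
  have hD : ∀ n, MeasurableSet (disjointed (fun n => T (e n)) n) :=
    MeasurableSet.disjointed fun n => hT _
  have hdisj : Pairwise (Function.onFun Disjoint fun n => s ∩ disjointed (fun n => T (e n)) n) :=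
    fun i j hij => (disjoint_disjointed _ hij).mono Set.inter_subset_right Set.inter_subset_right
  calc μ s ≤ μ ((⋃ n, s ∩ disjointed (fun n => T (e n)) n) ∪ (⋃ i, T i)ᶜ) := by
        refine measure_mono fun x hx => ?_
        rw [← Set.inter_iUnion, iUnion_disjointed, hU]
        by_cases hx' : x ∈ ⋃ i, T i
        · exact Or.inl ⟨hx, hx'⟩
        · exact Or.inr hx'
    _ ≤ μ (⋃ n, s ∩ disjointed (fun n => T (e n)) n) + μ (⋃ i, T i)ᶜ := measure_union_le _ _
    _ ≤ ∑' n, μ (s ∩ disjointed (fun n => T (e n)) n) := by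
        rw [h0, add_zero]; exact measure_iUnion_le _
    _ ≤ ∑' n, c * ν (s ∩ disjointed (fun n => T (e n)) n) :=
        ENNReal.tsum_le_tsum fun n => h (e n) _
          (Set.inter_subset_right.trans (disjointed_subset _ _)) (hs.inter (hD n))
    _ = c * ν (⋃ n, s ∩ disjointed (fun n => T (e n)) n) := by
        rw [ENNReal.tsum_mul_left, measure_iUnion hdisj fun n => hs.inter (hD n)]
    _ ≤ c * ν s := by
        gcongr
        exact Set.iUnion_subset fun n => Set.inter_subset_left

variable {b : OrthonormalBasis (Fin 3) ℝ E3} {γ : E2 → ℝ} {L : ℝ≥0}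

/-- Comparison of surface measure and of the surface element on a piece of a graph that is close
to a plane. -/
theorem graph_measure_comparison {a : E2 →L[ℝ] ℝ} {δ : ℝ≥0} {t : Set E2} (ht : MeasurableSet t)
    (happ : ApproximatesLinearOn (graphMap b γ) (graphDeriv b a) t δ)
    (hder : ∀ z ∈ t, ‖a - fderiv ℝ γ z‖ ≤ δ) :
    (μHE[2] : Measure E3) (graphMap b γ '' t) ≤ (1 + δ : ℝ≥0∞) ^ 3 *
        ∫⁻ z in t, ENNReal.ofReal (graphJacobian (fderiv ℝ γ z)) ∧
      ∫⁻ z in t, ENNReal.ofReal (graphJacobian (fderiv ℝ γ z)) ≤ (1 + δ : ℝ≥0∞) ^ 3 *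
        (μHE[2] : Measure E3) (graphMap b γ '' t) := by
  have hc : ((1 + δ : ℝ≥0) : ℝ≥0∞) = 1 + δ := by push_cast; rfl
  -- Both the graph map and its linear model do not contract distances, so an additive error δ‖z -
  -- w‖ costs a factor 1 + δ in either direction. In dimension two this gives (1 + δ)²; the
  -- variation of the Jacobian supplies the third factor.
  have hc' : ENNReal.ofReal (1 + δ) = 1 + δ := by
    rw [ENNReal.ofReal_add zero_le_one δ.coe_nonneg]; simp
  have hsub : ∀ z ∈ t, ∀ w ∈ t,
      ‖graphMap b γ z - graphMap b γ w - graphDeriv b a (z - w)‖ ≤ δ * ‖z - w‖ :=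
    fun z hz w hw => happ z hz w hw
  have hG : ∀ z w, ‖z - w‖ ≤ ‖graphMap b γ z - graphMap b γ w‖ := fun z w => by
    have : graphMap b γ z - graphMap b γ w = chartEmb b (z - w) + (γ z - γ w) • b 2 := by
      simp only [graphMap, map_sub, sub_smul]; abel
    rw [this]; exact norm_le_norm_chart b _ _
  have h1 : (μHE[2] : Measure E3) (graphMap b γ '' t) ≤
      (1 + δ : ℝ≥0∞) ^ 2 * (ENNReal.ofReal (graphJacobian a) * volume t) := by
    rw [← volume_image_graphDeriv b a, ← hc]
    refine euclideanHausdorffMeasure_image_le_of_dist_le 2 fun z hz w hw => ?_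
    rw [dist_eq_norm, dist_eq_norm, ← map_sub]
    have h2 := norm_sub_norm_le (graphMap b γ z - graphMap b γ w) (graphDeriv b a (z - w))
    have h3 : ‖z - w‖ ≤ ‖graphDeriv b a (z - w)‖ := norm_le_norm_chart b _ _
    have h4 := mul_le_mul_of_nonneg_left h3 δ.coe_nonneg
    have h5 := hsub z hz w hw
    push_cast
    linarith
  have h1' : ENNReal.ofReal (graphJacobian a) * volume t ≤
      (1 + δ : ℝ≥0∞) ^ 2 * (μHE[2] : Measure E3) (graphMap b γ '' t) := by
    rw [← volume_image_graphDeriv b a, ← hc]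
    refine euclideanHausdorffMeasure_image_le_of_dist_le 2 fun z hz w hw => ?_
    rw [dist_eq_norm, dist_eq_norm, ← map_sub]
    have h2 := norm_sub_norm_le (graphDeriv b a (z - w)) (graphMap b γ z - graphMap b γ w)
    have h4 := mul_le_mul_of_nonneg_left (hG z w) δ.coe_nonneg
    have h5 := hsub z hz w hw
    rw [norm_sub_rev] at h5
    push_cast
    linarith
  have hconst : ∀ r : ℝ≥0∞, ∫⁻ _ in t, r = r * volume t := fun r => by simp
  have h6 : ENNReal.ofReal (graphJacobian a) * volume t ≤
      (1 + δ) * ∫⁻ z in t, ENNReal.ofReal (graphJacobian (fderiv ℝ γ z)) := by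
    rw [← hconst, ← lintegral_const_mul' _ _ (by simp)]
    refine setLIntegral_mono' ht fun z hz => ?_
    rw [← hc', ← ENNReal.ofReal_mul (by positivity)]
    exact ENNReal.ofReal_le_ofReal (graphJacobian_le δ.coe_nonneg (hder z hz))
  have h6' : ∫⁻ z in t, ENNReal.ofReal (graphJacobian (fderiv ℝ γ z)) ≤
      (1 + δ) * (ENNReal.ofReal (graphJacobian a) * volume t) := by
    rw [← hconst, ← lintegral_const_mul' _ _ (by simp)]
    refine setLIntegral_mono' ht fun z hz => ?_
    rw [← hc', ← ENNReal.ofReal_mul (by positivity)]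
    exact ENNReal.ofReal_le_ofReal (graphJacobian_le δ.coe_nonneg (by rw [norm_sub_rev]; exact hder z hz))
  constructor
  · refine h1.trans ?_
    rw [pow_succ (1 + δ : ℝ≥0∞) 2, mul_assoc]
    gcongr
  · refine h6'.trans ?_
    rw [pow_succ' (1 + δ : ℝ≥0∞) 2, mul_assoc]
    gcongr

/-- By Rademacher almost every point is a differentiability point. These are first sorted by the
approximate value of the derivative, then cut into pieces on which the graph map is nearly linear.
-/
theorem exists_graph_cover (hγ : LipschitzWith L γ) {δ : ℝ≥0} (hδ : 0 < δ) :
    ∃ T : ℕ × ℕ → Set E2, (∀ i, MeasurableSet (T i)) ∧ volume (⋃ i, T i)ᶜ = 0 ∧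
      ∀ i, ∃ a : E2 →L[ℝ] ℝ, ApproximatesLinearOn (graphMap b γ) (graphDeriv b a) (T i) δ ∧
        ∀ z ∈ T i, ‖a - fderiv ℝ γ z‖ ≤ δ := by
  -- Radius δ/2, so that any two derivatives in one class differ by less than δ.
  let S : ℕ → Set E2 := fun k => {z | DifferentiableAt ℝ γ z} ∩
    fderiv ℝ γ ⁻¹' Metric.ball (TopologicalSpace.denseSeq (E2 →L[ℝ] ℝ) k) (δ / 2)
  have hS : ∀ k, MeasurableSet (S k) := fun k =>
    (measurableSet_of_differentiableAt ℝ γ).inter (measurable_fderiv ℝ γ measurableSet_ball)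
  have hder : ∀ k, ∀ z ∈ S k, HasFDerivWithinAt (graphMap b γ)
      (graphDeriv b (fderiv ℝ γ z)) (S k) z := fun k z hz =>
    (hasFDerivAt_graphMap hz.1.hasFDerivAt).hasFDerivWithinAt
  choose t A _ htm hcov happ hA using fun k =>
    exists_partition_approximatesLinearOn_of_hasFDerivWithinAt (graphMap b γ) (S k) _ (hder k)
      (fun _ => δ) (fun _ => hδ.ne')
  refine ⟨fun i => S i.1 ∩ t i.1 i.2, fun i => (hS _).inter (htm _ _), ?_, fun i => ?_⟩
  · refine measure_mono_null ?_ (ae_iff.1 (hγ.ae_differentiableAt (μ := volume)))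
    intro z hz hd
    refine hz ?_
    obtain ⟨k, hk⟩ := (TopologicalSpace.denseRange_denseSeq (E2 →L[ℝ] ℝ)).exists_dist_lt
      (fderiv ℝ γ z) (half_pos hδ)
    have hzk : z ∈ S k := ⟨hd, hk⟩
    obtain ⟨n, hn⟩ := Set.mem_iUnion.1 (hcov k hzk)
    exact Set.mem_iUnion.2 ⟨(k, n), hzk, hn⟩
  · by_cases hne : (S i.1).Nonempty
    · obtain ⟨y, hy, hAy⟩ := hA i.1 hne i.2
      refine ⟨fderiv ℝ γ y, ?_, fun z hz => ?_⟩
      · have := happ i.1 i.2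
        rwa [hAy] at this
      · have h1 : dist (fderiv ℝ γ y) _ < _ := hy.2
        have h2 : dist (fderiv ℝ γ z) _ < _ := hz.1.2
        rw [← dist_eq_norm]
        have := dist_triangle_right (fderiv ℝ γ y) (fderiv ℝ γ z)
          (TopologicalSpace.denseSeq (E2 →L[ℝ] ℝ) i.1)
        linarith
    -- The piece is empty, so any linear map serves.
    · rw [Set.not_nonempty_iff_eq_empty] at hne
      refine ⟨0, ?_, ?_⟩
      · simp [hne]
      · simp [hne]

/-- The surface measure on the parameter domain of a graph. -/
def graphMeasure (γ : E2 → ℝ) : Measure E2 :=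
  volume.withDensity fun z => ENNReal.ofReal (graphJacobian (fderiv ℝ γ z))

theorem measurable_graphJacobian_fderiv (γ : E2 → ℝ) :
    Measurable fun z => graphJacobian (fderiv ℝ γ z) :=
  continuous_graphJacobian.measurable.comp (measurable_fderiv ℝ γ)

/-- The area formula for the graph of a Lipschitz function. -/
theorem comap_graphMap (hγ : LipschitzWith L γ) :
    (μHE[2] : Measure E3).comap (graphMap b γ) = graphMeasure γ := by
  have hemb := measurableEmbedding_graphMap (b := b) hγ.continuous
  have hlim : Tendsto (fun n : ℕ => (1 + ((1 / ((n : ℝ≥0) + 1) : ℝ≥0) : ℝ≥0∞)) ^ 3) atTop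
      (𝓝 1) := by
    have h0 : Tendsto (fun n : ℕ => (1 + (1 / ((n : ℝ≥0) + 1) : ℝ≥0)) ^ 3) atTop (𝓝 1) := by
      simpa using (tendsto_const_nhds (x := (1 : ℝ≥0))).add
        (tendsto_one_div_add_atTop_nhds_zero_nat (𝕜 := ℝ≥0)) |>.pow 3
    have h1 := ENNReal.tendsto_coe.2 h0
    rw [ENNReal.coe_one] at h1
    refine h1.congr fun n => ?_
    rw [ENNReal.coe_pow, ENNReal.coe_add, ENNReal.coe_one]
  -- The cover misses a Lebesgue null set; its image in the graph is null too, because the graph map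
  -- is Lipschitz.
  have hnull : ∀ s : Set E2, volume s = 0 → (μHE[2] : Measure E3) (graphMap b γ '' s) = 0 := by
    intro s hs
    have hlip : LipschitzWith (1 + L) (graphMap b γ) := by
      simpa using lipschitzWith_graphMap (b := b) hγ 0
    have h := euclideanHausdorffMeasure_image_le_of_dist_le (f := graphMap b γ) (g := id) (s := s)
      2 fun x _ y _ => hlip.dist_le_mul x y
    rw [Set.image_id, EuclideanSpace.euclideanHausdorffMeasure_eq_volume, hs, mul_zero] at h
    exact le_antisymm h zero_le
  -- Two-sided comparison with δ = 1/(n + 1); the constants tend to 1.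
  have key : ∀ s, MeasurableSet s → ∀ n : ℕ,
      (μHE[2] : Measure E3).comap (graphMap b γ) s ≤
          (1 + ((1 / ((n : ℝ≥0) + 1) : ℝ≥0) : ℝ≥0∞)) ^ 3 * graphMeasure γ s ∧
        graphMeasure γ s ≤ (1 + ((1 / ((n : ℝ≥0) + 1) : ℝ≥0) : ℝ≥0∞)) ^ 3 *
          (μHE[2] : Measure E3).comap (graphMap b γ) s := by
    intro s hs n
    obtain ⟨T, hT, hT0, hTa⟩ := exists_graph_cover (b := b) hγ
      (δ := 1 / ((n : ℝ≥0) + 1)) (by positivity)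
    constructor
    · refine measure_le_mul_of_cover hT ?_ (fun i t hti ht => ?_) hs
      · rw [hemb.comap_apply]; exact hnull _ hT0
      · obtain ⟨a, ha, ha'⟩ := hTa i
        rw [hemb.comap_apply, graphMeasure, withDensity_apply _ ht]
        exact (graph_measure_comparison ht (ha.mono_set hti) fun z hz => ha' z (hti hz)).1
    · refine measure_le_mul_of_cover hT ?_ (fun i t hti ht => ?_) hs
      · exact withDensity_absolutelyContinuous _ _ hT0
      · obtain ⟨a, ha, ha'⟩ := hTa i
        rw [hemb.comap_apply, graphMeasure, withDensity_apply _ ht]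
        exact (graph_measure_comparison ht (ha.mono_set hti) fun z hz => ha' z (hti hz)).2
  ext s hs
  have hlim' : ∀ r : ℝ≥0∞, Tendsto (fun n : ℕ =>
      (1 + ((1 / ((n : ℝ≥0) + 1) : ℝ≥0) : ℝ≥0∞)) ^ 3 * r) atTop (𝓝 r) := fun r => by
    simpa using ENNReal.Tendsto.mul_const hlim (b := r) (Or.inl one_ne_zero)
  exact le_antisymm (ge_of_tendsto' (hlim' _) fun n => (key s hs n).1)
    (ge_of_tendsto' (hlim' _) fun n => (key s hs n).2)

theorem map_graphMap (hγ : LipschitzWith L γ) :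
    (graphMeasure γ).map (graphMap b γ) =
      (μHE[2] : Measure E3).restrict (Set.range (graphMap b γ)) := by
  rw [← comap_graphMap (b := b) hγ, (measurableEmbedding_graphMap hγ.continuous).map_comap]

end PhysicalOptics
end

/-! ### The divergence theorem over a Lipschitz epigraph. -/

noncomputable section
namespace PhysicalOptics

open Filter Topology Module
open scoped ENNReal NNReal

/-- The integral of a directional derivative of a compactly supported Lipschitz function
vanishes. -/
theorem integral_lineDeriv_eq_zero {E : Type*} [NormedAddCommGroup E] [NormedSpace ℝ E]
    [FiniteDimensional ℝ E] [MeasurableSpace E] [BorelSpace E] {μ : Measure E}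
    [μ.IsAddHaarMeasure] {g : E → ℝ} {C : ℝ≥0} (hg : LipschitzWith C g)
    (h'g : HasCompactSupport g) (v : E) : ∫ z, lineDeriv ℝ g z v ∂μ = 0 := by
  have h := LipschitzWith.integral_lineDeriv_mul_eq (μ := μ)
    (LipschitzWith.const (1 : ℝ) : LipschitzWith 0 fun _ : E => (1 : ℝ)) hg h'g (-v)
  have h0 : ∀ z, lineDeriv ℝ (fun _ : E => (1 : ℝ)) z (-v) = 0 := fun z => by simp [lineDeriv]
  simp only [h0, zero_mul, integral_zero, neg_neg, mul_one] at h
  exact h.symm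

variable {b : OrthonormalBasis (Fin 3) ℝ E3} {γ : E2 → ℝ} {L : ℝ≥0}

/-- Coordinates in which the graph of `γ` is flat. -/
def shearMap (b : OrthonormalBasis (Fin 3) ℝ E3) (γ : E2 → ℝ) (q : E2 × ℝ) : E3 :=
  graphMap b (fun z => γ z + q.2) q.1

theorem shearMap_eq (q : E2 × ℝ) : shearMap b γ q = graphMap b γ q.1 + q.2 • b 2 := by
  simp only [shearMap, graphMap, add_smul]; abel

theorem continuous_shearMap (hγ : Continuous γ) : Continuous (shearMap b γ) := by
  unfold shearMap graphMap; fun_prop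

/-- The shear translates each vertical line by γ z, so continuity of γ suffices. -/
theorem measurePreserving_shearMap (hγ : Continuous γ) :
    MeasurePreserving (shearMap b γ) volume volume := by
  have h : MeasurePreserving (fun q : E2 × ℝ => (q.1, γ q.1 + q.2))
      (volume.prod volume) (volume.prod volume) :=
    (MeasurePreserving.id volume).skew_product (g := fun z t => γ z + t)
      (by unfold Function.uncurry; fun_prop)
      (ae_of_all _ fun z => (measurePreserving_add_left volume (γ z)).map_eq)
  exact (measurePreserving_chart b).comp h

theorem hasCompactSupport_comp_shearMap {F : Type*} [Zero F] (hγ : Continuous γ) {g : E3 → F}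
    (hg : HasCompactSupport g) : HasCompactSupport (g ∘ shearMap b γ) := by
  refine HasCompactSupport.of_support_subset_isCompact
    (K := (fun y => (chartProj b y, ⟪b 2, y⟫ - γ (chartProj b y))) '' tsupport g) ?_ ?_
  · exact hg.isCompact.image (by fun_prop)
  · intro q hq
    refine ⟨shearMap b γ q, subset_tsupport _ hq, ?_⟩
    ext1 <;> simp [shearMap]

theorem shearMap_mem_epigraph (q : E2 × ℝ) :
    γ (chartProj b (shearMap b γ q)) < ⟪b 2, shearMap b γ q⟫ ↔ 0 < q.2 := by
  simp [shearMap]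

theorem measurableEmbedding_shearMap (hγ : Continuous γ) :
    MeasurableEmbedding (shearMap b γ) := by
  refine (continuous_shearMap hγ).measurableEmbedding fun q r h => ?_
  have h1 := congrArg (chartProj b) h
  have h2 := congrArg (fun y => ⟪b 2, y⟫) h
  simp only [shearMap, chartProj_graphMap, inner_normal_graphMap] at h1 h2
  rw [h1] at h2
  exact Prod.ext h1 (add_left_cancel h2)

theorem setIntegral_epigraph (hγ : Continuous γ) (g : E3 → ℝ) :
    ∫ y in {y | γ (chartProj b y) < ⟪b 2, y⟫}, g y =
      ∫ q in {q : E2 × ℝ | 0 < q.2}, g (shearMap b γ q) := by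
  rw [← (measurePreserving_shearMap (b := b) hγ).setIntegral_preimage_emb
    (measurableEmbedding_shearMap hγ)]
  congr 2
  ext q
  exact shearMap_mem_epigraph q

theorem integral_Ioi_fderiv_ray {f : E3 → ℝ} (hf : ContDiff ℝ 1 f) (hfc : HasCompactSupport f)
    (x : E3) {v : E3} (hv : ‖v‖ = 1) :
    ∫ t in Set.Ioi (0 : ℝ), fderiv ℝ f (x + t • v) v = -f x := by
  have hg : ContDiff ℝ 1 fun t : ℝ => f (x + t • v) := hf.comp (by fun_prop)
  have hgc : HasCompactSupport fun t : ℝ => f (x + t • v) := by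
    refine HasCompactSupport.of_support_subset_isCompact
      (K := (fun y => ⟪v, y - x⟫) '' tsupport f) (hfc.isCompact.image (by fun_prop)) ?_
    exact fun t ht => ⟨_, subset_tsupport _ ht, by simp [inner_smul_right, hv]⟩
  have hd : ∀ t : ℝ, deriv (fun t : ℝ => f (x + t • v)) t = fderiv ℝ f (x + t • v) v := by
    intro t
    refine HasDerivAt.deriv ?_
    refine ((hf.differentiable one_ne_zero _).hasFDerivAt).comp_hasDerivAt t ?_
    simpa using ((hasDerivAt_id t).smul_const v).const_add x
  have h := hgc.integral_Ioi_deriv_eq hg 0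
  simpa [hd] using h

/-- The divergence theorem over the epigraph of a Lipschitz function. -/
theorem integral_epigraph_fderiv (hγ : LipschitzWith L γ) {f : E3 → ℝ} (hf : ContDiff ℝ 1 f)
    (hfc : HasCompactSupport f) (a : E3) :
    ∫ y in {y | γ (chartProj b y) < ⟪b 2, y⟫}, fderiv ℝ f y a =
      ∫ z, f (graphMap b γ z) * (fderiv ℝ γ z (chartProj b a) - ⟪b 2, a⟫) := by
  have hc := hγ.continuous
  have hcd : ∀ v, Continuous fun y => fderiv ℝ f y v := fun v =>
    (hf.continuous_fderiv one_ne_zero).clm_apply continuous_const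
  have hsd : ∀ v, HasCompactSupport fun y => fderiv ℝ f y v := fun v => hfc.fderiv_apply ℝ v
  have hint : ∀ v, Integrable (fun q : E2 × ℝ => fderiv ℝ f (shearMap b γ q) v)
      (volume.prod volume) := fun v =>
    ((hcd v).comp (continuous_shearMap (b := b) hc)).integrable_of_hasCompactSupport
      (hasCompactSupport_comp_shearMap hc (hsd v))
  have hdiff : ∀ y, HasFDerivAt f (fderiv ℝ f y) y := fun y =>
    (hf.differentiable one_ne_zero y).hasFDerivAt
  set a' := chartProj b a with ha'
  set s := ⟪b 2, a⟫ with hs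
  have ha : a = chartEmb b a' + s • b 2 := (chartEmb_chartProj_add b a).symm
  let ρ : E2 → ℝ := fun z => fderiv ℝ γ z a' - s
  have hρm : Measurable ρ := (measurable_fderiv_apply_const ℝ γ a').sub_const s
  have hρb : ∀ z, ‖ρ z‖ ≤ L * ‖a'‖ + |s| := fun z => by
    refine (norm_sub_le _ _).trans (add_le_add ?_ le_rfl)
    exact ((fderiv ℝ γ z).le_opNorm _).trans
      (mul_le_mul_of_nonneg_right (norm_fderiv_le_of_lipschitz ℝ hγ) (norm_nonneg _))
  have hint2 : Integrable (fun q : E2 × ℝ => ρ q.1 * fderiv ℝ f (shearMap b γ q) (b 2))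
      (volume.prod volume) :=
    (hint (b 2)).bdd_mul (c := L * ‖a'‖ + |s|) (hρm.comp measurable_fst).aestronglyMeasurable
      (ae_of_all _ fun q => hρb q.1)
  -- the derivative of `f` along the graph
  have hline : ∀ t, ∀ᵐ z, lineDeriv ℝ (fun z => f (shearMap b γ (z, t))) z a' =
      fderiv ℝ f (shearMap b γ (z, t)) a + ρ z * fderiv ℝ f (shearMap b γ (z, t)) (b 2) := by
    intro t
    filter_upwards [hγ.ae_differentiableAt (μ := volume)] with z hz
    have h1 : HasFDerivAt (fun z => shearMap b γ (z, t)) (graphDeriv b (fderiv ℝ γ z)) z :=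
      hasFDerivAt_graphMap (hz.hasFDerivAt.add_const t)
    have h2 := ((hdiff _).comp z h1).hasLineDerivAt a'
    have h3 := h2.lineDeriv
    rw [Function.comp_def] at h3
    rw [h3, ContinuousLinearMap.comp_apply, graphDeriv_apply]
    conv_rhs => rw [ha]
    simp only [map_add, map_smul, smul_eq_mul, ρ]
    ring
  have hzero : ∀ t, ∫ z, (fderiv ℝ f (shearMap b γ (z, t)) a +
      ρ z * fderiv ℝ f (shearMap b γ (z, t)) (b 2)) = 0 := by
    intro t
    rw [← integral_congr_ae (hline t)]
    obtain ⟨C, hC⟩ := hf.lipschitzWith_of_hasCompactSupport hfc one_ne_zero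
    refine integral_lineDeriv_eq_zero (hC.comp (lipschitzWith_graphMap (b := b) hγ t)) ?_ a'
    refine HasCompactSupport.of_support_subset_isCompact (K := chartProj b '' tsupport f)
      (hfc.isCompact.image (by fun_prop)) fun z hz => ⟨_, subset_tsupport _ hz, by simp⟩
  -- integration along the vertical direction
  have hvert : ∀ z, ∫ t in Set.Ioi (0 : ℝ), fderiv ℝ f (shearMap b γ (z, t)) (b 2) =
      -f (graphMap b γ z) := by
    intro z
    simp only [shearMap_eq]
    exact integral_Ioi_fderiv_ray hf hfc _ (by simp)
  have hset : {q : E2 × ℝ | 0 < q.2} = Set.univ ×ˢ Set.Ioi 0 := by ext; simp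
  rw [setIntegral_epigraph hc, hset, Measure.volume_eq_prod]
  -- Fubini with z innermost: on every translate of the graph the tangential derivative integrates
  -- to zero. This trades ∂ₐf for -ρ ∂f/∂(b 2). As ρ is independent of height, the latter integrates
  -- vertically to boundary values of f, and γ is differentiated only once.
  have hsum : ∫ q in Set.univ ×ˢ Set.Ioi (0 : ℝ), (fderiv ℝ f (shearMap b γ q) a +
      ρ q.1 * fderiv ℝ f (shearMap b γ q) (b 2)) ∂(volume.prod volume) = 0 := by
    rw [← Measure.prod_restrict, Measure.restrict_univ, integral_prod_symm]
    · simp [hzero]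
    · have := ((hint a).add hint2).restrict (s := Set.univ ×ˢ Set.Ioi (0 : ℝ))
      rwa [← Measure.prod_restrict, Measure.restrict_univ] at this
  rw [integral_add (hint a).restrict hint2.restrict] at hsum
  rw [eq_neg_of_add_eq_zero_left hsum, setIntegral_prod _ hint2.integrableOn, ← integral_neg,
    Measure.restrict_univ]
  refine integral_congr_ae (ae_of_all _ fun z => ?_)
  simp only [integral_const_mul, hvert, ρ]
  ring

end PhysicalOptics
end

/-! ### Boundary charts, normals and surface integrals. -/

noncomputable section
namespace PhysicalOptics

open Filter Topology Module
open scoped ENNReal NNReal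

theorem IsOutwardNormal.normal_eq {D : Set E3} {x ν : E3} (h : IsOutwardNormal D x ν) :
    normal D x = ν := by
  have hex : ∃ ν, IsOutwardNormal D x ν := ⟨ν, h⟩
  rw [normal, dif_pos hex]
  exact hex.choose_spec.unique h

theorem norm_normal_le (D : Set E3) (x : E3) : ‖normal D x‖ ≤ 1 := by
  unfold normal
  split_ifs with h
  · exact h.choose_spec.1.le
  · simp

/-- In the bounded open set `U`, the set `D` is the region above the graph of `γ`. -/
structure IsGraphChart (D : Set E3) (b : OrthonormalBasis (Fin 3) ℝ E3) (L : ℝ≥0) (γ : E2 → ℝ)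
    (U : Set E3) : Prop where
  lipschitz : LipschitzWith L γ
  isOpen : IsOpen U
  isBounded : Bornology.IsBounded U
  mem_iff : ∀ y ∈ U, y ∈ D ↔ γ (chartProj b y) < ⟪b 2, y⟫

theorem HasLipschitzBoundary.exists_isGraphChart {D : Set E3} (h : HasLipschitzBoundary D) {x : E3}
    (hx : x ∈ frontier D) : ∃ b L γ U, x ∈ U ∧ IsGraphChart D b L γ U := by
  obtain ⟨b, L, γ, U, hγ, hU, hxU, hD⟩ := h x hx
  -- The unit ball makes the chart bounded, which gives finite surface measure and compact supports.
  exact ⟨b, L, γ, U ∩ Metric.ball x 1, ⟨hxU, Metric.mem_ball_self one_pos⟩, hγ,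
    hU.inter Metric.isOpen_ball, Metric.isBounded_ball.subset Set.inter_subset_right,
    fun y hy => hD y hy.1⟩

/-- The outward normal of an epigraph at a point where the function has derivative `a`. -/
def graphNormal (b : OrthonormalBasis (Fin 3) ℝ E3) (a : E2 →L[ℝ] ℝ) : E3 :=
  (graphJacobian a)⁻¹ • (chartEmb b ((InnerProductSpace.toDual ℝ E2).symm a) - b 2)

variable {D U : Set E3} {b : OrthonormalBasis (Fin 3) ℝ E3} {γ : E2 → ℝ} {L : ℝ≥0}

theorem inner_graphNormal (a : E2 →L[ℝ] ℝ) (y : E3) :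
    ⟪graphNormal b a, y⟫ = (graphJacobian a)⁻¹ * (a (chartProj b y) - ⟪b 2, y⟫) := by
  simp [graphNormal, real_inner_smul_left, inner_sub_left, inner_chartEmb]

theorem norm_graphNormal (a : E2 →L[ℝ] ℝ) : ‖graphNormal b a‖ = 1 := by
  have h := norm_sq_chart b ((InnerProductSpace.toDual ℝ E2).symm a) (-1)
  rw [neg_one_smul, ← sub_eq_add_neg, LinearIsometryEquiv.norm_map, neg_one_sq, add_comm,
    ← graphJacobian_sq, sq_eq_sq₀ (norm_nonneg _) (graphJacobian_pos a).le] at h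
  rw [graphNormal, norm_smul, h, norm_inv, Real.norm_of_nonneg (graphJacobian_pos a).le,
    inv_mul_cancel₀ (graphJacobian_pos a).ne']

theorem measurable_graphNormal : Measurable fun z => graphNormal b (fderiv ℝ γ z) := by
  unfold graphNormal
  have h1 := measurable_graphJacobian_fderiv γ
  have h2 := measurable_fderiv ℝ γ
  have h3 : Measurable fun z =>
      chartEmb b ((InnerProductSpace.toDual ℝ E2).symm (fderiv ℝ γ z)) :=
    ((chartEmb b).continuous.comp
      (InnerProductSpace.toDual ℝ E2).symm.continuous).measurable.comp h2
  exact h1.inv.smul (h3.sub_const _)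

theorem norm_chartProj_le (y : E3) : ‖chartProj b y‖ ≤ ‖y‖ := by
  have := norm_le_norm_chart b (chartProj b y) ⟪b 2, y⟫
  rwa [chartEmb_chartProj_add] at this

namespace IsGraphChart

theorem mem_frontier_iff (h : IsGraphChart D b L γ U) {y : E3} (hy : y ∈ U) :
    y ∈ frontier D ↔ y ∈ Set.range (graphMap b γ) := by
  have hc : Continuous fun y => γ (chartProj b y) :=
    h.lipschitz.continuous.comp (chartProj b).continuous
  have hU := h.isOpen.mem_nhds hy
  rw [mem_range_graphMap]
  constructor
  · intro hf
    by_contra hne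
    rcases lt_or_gt_of_ne hne with hlt | hgt
    · have hev : ∀ᶠ y in 𝓝 y, y ∉ D := by
        filter_upwards [hU, (continuous_const.inner continuous_id).continuousAt.eventually_lt
          hc.continuousAt hlt] with y hyU hy
        rw [h.mem_iff y hyU]
        exact not_lt.2 hy.le
      exact mem_closure_iff_frequently.1 hf.1 hev
    · have hev : ∀ᶠ y in 𝓝 y, y ∈ D := by
        filter_upwards [hU, hc.continuousAt.eventually_lt
          (continuous_const.inner continuous_id).continuousAt hgt] with y hyU hy
        exact (h.mem_iff y hyU).2 hy
      exact hf.2 (mem_interior_iff_mem_nhds.2 hev)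
  · intro heq
    refine ⟨?_, fun hi => ?_⟩
    · have ht : Tendsto (fun t : ℝ => y + t • b 2) (𝓝[>] 0) (𝓝 y) := by
        have : Continuous fun t : ℝ => y + t • b 2 := by fun_prop
        simpa using (this.tendsto 0).mono_left nhdsWithin_le_nhds
      refine mem_closure_of_tendsto ht ?_
      filter_upwards [ht hU, self_mem_nhdsWithin] with t htU ht0
      rw [h.mem_iff _ htU]
      simpa [inner_add_right, inner_smul_right, heq] using ht0
    · have := (h.mem_iff y hy).1 (interior_subset hi)
      exact this.ne' heq

theorem isOutwardNormal (h : IsGraphChart D b L γ U) {z : E2} (hz : DifferentiableAt ℝ γ z)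
    (hU : graphMap b γ z ∈ U) :
    IsOutwardNormal D (graphMap b γ z) (graphNormal b (fderiv ℝ γ z)) := by
  refine ⟨norm_graphNormal _, fun ε hε => ?_⟩
  have hJ := graphJacobian_pos (fderiv ℝ γ z)
  -- The tolerance is ε times the Jacobian, to absorb the normalizing factor of `graphNormal`.
  have hd := hz.hasFDerivAt.isLittleO.def (mul_pos hε hJ)
  have htend : Tendsto (chartProj b) (𝓝 (graphMap b γ z)) (𝓝 z) := by
    have := (chartProj b).continuous.tendsto (graphMap b γ z)
    rwa [chartProj_graphMap] at this
  obtain ⟨r, hr, hball⟩ := Metric.eventually_nhds_iff_ball.1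
    ((htend.eventually hd).and (h.isOpen.mem_nhds hU))
  refine ⟨r, hr, fun y hy => ?_⟩
  obtain ⟨h1, hyU⟩ := hball y hy
  rw [h.mem_iff y hyU, real_inner_comm, inner_graphNormal, map_sub, chartProj_graphMap,
    inner_sub_right, inner_normal_graphMap]
  have h2 : ‖chartProj b y - z‖ ≤ ‖y - graphMap b γ z‖ := by
    simpa using norm_chartProj_le (b := b) (y - graphMap b γ z)
  have h3 := h1.trans (mul_le_mul_of_nonneg_left h2 (mul_pos hε hJ).le)
  rw [Real.norm_eq_abs, abs_le] at h3
  set a := fderiv ℝ γ z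
  constructor
  · intro hlt
    rw [inv_mul_lt_iff₀ hJ] at hlt
    nlinarith
  · intro hlt
    rw [lt_inv_mul_iff₀ hJ] at hlt
    rw [not_lt]
    nlinarith

theorem restrict_surfaceMeasure (h : IsGraphChart D b L γ U) :
    (surfaceMeasure D).restrict U = ((graphMeasure γ).map (graphMap b γ)).restrict U := by
  rw [map_graphMap h.lipschitz, surfaceMeasure, Measure.restrict_restrict h.isOpen.measurableSet,
    Measure.restrict_restrict h.isOpen.measurableSet]
  congr 1
  ext y
  exact and_congr_right fun hy => h.mem_frontier_iff hy

theorem ae_normal_eq (h : IsGraphChart D b L γ U) :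
    ∀ᵐ z ∂graphMeasure γ, graphMap b γ z ∈ U →
      normal D (graphMap b γ z) = graphNormal b (fderiv ℝ γ z) := by
  refine withDensity_absolutelyContinuous _ _ ?_
  filter_upwards [h.lipschitz.ae_differentiableAt (μ := volume)] with z hz hU
  exact (h.isOutwardNormal hz hU).normal_eq

theorem aemeasurable_normal (h : IsGraphChart D b L γ U) :
    AEMeasurable (normal D) ((surfaceMeasure D).restrict U) := by
  have hemb := measurableEmbedding_graphMap (b := b) h.lipschitz.continuous
  refine ⟨fun y => graphNormal b (fderiv ℝ γ (chartProj b y)),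
    measurable_graphNormal.comp (chartProj b).continuous.measurable, ?_⟩
  rw [h.restrict_surfaceMeasure, EventuallyEq, ae_restrict_iff' h.isOpen.measurableSet,
    hemb.ae_map_iff]
  filter_upwards [h.ae_normal_eq] with z hz hU
  rw [hz hU, chartProj_graphMap]

theorem surfaceMeasure_lt_top (h : IsGraphChart D b L γ U) : surfaceMeasure D U < ∞ := by
  rw [← Measure.restrict_apply_univ, h.restrict_surfaceMeasure, Measure.restrict_apply_univ,
    Measure.map_apply (continuous_graphMap h.lipschitz.continuous).measurable
      h.isOpen.measurableSet, graphMeasure, withDensity_apply _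
      ((continuous_graphMap h.lipschitz.continuous).measurable h.isOpen.measurableSet)]
  obtain ⟨R, hR⟩ := h.isBounded.subset_closedBall 0
  have hsub : graphMap b γ ⁻¹' U ⊆ Metric.closedBall 0 R := by
    intro z hz
    have h1 := hR hz
    rw [mem_closedBall_zero_iff] at h1 ⊢
    exact (norm_le_norm_chart b z (γ z)).trans h1
  have hJ : ∀ z, graphJacobian (fderiv ℝ γ z) ≤ √(1 + (L : ℝ) ^ 2) := fun z => by
    refine Real.sqrt_le_sqrt ?_
    gcongr
    exact norm_fderiv_le_of_lipschitz ℝ h.lipschitz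
  calc ∫⁻ z in graphMap b γ ⁻¹' U, ENNReal.ofReal (graphJacobian (fderiv ℝ γ z))
      ≤ ∫⁻ z in graphMap b γ ⁻¹' U, ENNReal.ofReal √(1 + (L : ℝ) ^ 2) :=
        lintegral_mono fun z => ENNReal.ofReal_le_ofReal (hJ z)
    _ = ENNReal.ofReal √(1 + (L : ℝ) ^ 2) * volume (graphMap b γ ⁻¹' U) := by simp
    _ < ∞ := ENNReal.mul_lt_top ENNReal.ofReal_lt_top
        ((measure_mono hsub).trans_lt measure_closedBall_lt_top)

/-- The surface element cancels the normalizing factor of the normal, leaving the boundary term of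
`integral_epigraph_fderiv`. -/
theorem integral_mul_inner_normal (h : IsGraphChart D b L γ U) {f : E3 → ℝ}
    (hf : ∀ y, y ∉ U → f y = 0) (a : E3) :
    ∫ y, f y * ⟪normal D y, a⟫ ∂surfaceMeasure D =
      ∫ z, f (graphMap b γ z) * (fderiv ℝ γ z (chartProj b a) - ⟪b 2, a⟫) := by
  have hemb := measurableEmbedding_graphMap (b := b) h.lipschitz.continuous
  have h0 : ∀ y, y ∉ U → f y * ⟪normal D y, a⟫ = 0 := fun y hy => by rw [hf y hy, zero_mul]
  rw [← setIntegral_eq_integral_of_forall_compl_eq_zero h0, h.restrict_surfaceMeasure,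
    setIntegral_eq_integral_of_forall_compl_eq_zero h0, hemb.integral_map, graphMeasure,
    integral_withDensity_eq_integral_toReal_smul
      (measurable_graphJacobian_fderiv γ).ennreal_ofReal (by simp)]
  have hae : ∀ᵐ z, graphMap b γ z ∈ U →
      normal D (graphMap b γ z) = graphNormal b (fderiv ℝ γ z) := by
    filter_upwards [h.lipschitz.ae_differentiableAt (μ := volume)] with z hz hU
    exact (h.isOutwardNormal hz hU).normal_eq
  refine integral_congr_ae ?_
  filter_upwards [hae] with z hz
  have hJ := graphJacobian_pos (fderiv ℝ γ z)
  rw [ENNReal.toReal_ofReal hJ.le, smul_eq_mul]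
  by_cases hU : graphMap b γ z ∈ U
  · rw [hz hU, inner_graphNormal]
    field_simp
  · simp [hf _ hU]

/-- The divergence theorem for functions supported in a chart. -/
theorem integral_fderiv (h : IsGraphChart D b L γ U) (hD : IsOpen D) {f : E3 → ℝ}
    (hf : ContDiff ℝ 1 f) (hfU : tsupport f ⊆ U) (a : E3) :
    ∫ y in D, fderiv ℝ f y a = ∫ y, f y * ⟪normal D y, a⟫ ∂surfaceMeasure D := by
  have hfc : HasCompactSupport f :=
    Metric.isCompact_of_isClosed_isBounded (isClosed_tsupport f) (h.isBounded.subset hfU)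
  have h0 : ∀ y, y ∉ U → fderiv ℝ f y a = 0 := fun y hy => by
    rw [image_eq_zero_of_notMem_tsupport fun hy' => hy (hfU (tsupport_fderiv_subset ℝ hy'))]
    rfl
  have hepi : MeasurableSet {y : E3 | γ (chartProj b y) < ⟪b 2, y⟫} :=
    measurableSet_lt (h.lipschitz.continuous.comp (chartProj b).continuous).measurable
      (by fun_prop)
  rw [h.integral_mul_inner_normal fun y hy =>
    image_eq_zero_of_notMem_tsupport fun hy' => hy (hfU hy'),
    ← integral_epigraph_fderiv h.lipschitz hf hfc a, ← integral_indicator hD.measurableSet,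
    ← integral_indicator hepi]
  -- Inside U, D coincides with the epigraph; outside U the derivative vanishes.
  congr 1
  ext y
  by_cases hy : y ∈ U
  · by_cases hyD : y ∈ D
    · rw [Set.indicator_of_mem hyD, Set.indicator_of_mem]
      exact (h.mem_iff y hy).1 hyD
    · rw [Set.indicator_of_notMem hyD, Set.indicator_of_notMem]
      exact fun hy' => hyD ((h.mem_iff y hy).2 hy')
  · have h1 : ∀ s : Set E3, s.indicator (fun y => fderiv ℝ f y a) y = 0 := fun s =>
      Set.indicator_apply_eq_zero.2 fun _ => h0 y hy
    rw [h1, h1]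

end IsGraphChart

end PhysicalOptics
end

/-! ### The divergence theorem on bounded Lipschitz domains. -/

noncomputable section
namespace PhysicalOptics

open Filter Topology Module
open scoped ENNReal NNReal Manifold ContDiff

variable {D : Set E3}

/-- Finitely many charts cover the boundary of a bounded set with Lipschitz boundary. -/
theorem exists_finite_graphChart_cover (hb : Bornology.IsBounded D) (hl : HasLipschitzBoundary D) :
    ∃ (ι : Type) (_ : Fintype ι) (U : ι → Set E3), frontier D ⊆ ⋃ i, U i ∧
      ∀ i, ∃ b L γ, IsGraphChart D b L γ (U i) := by
  have hcomp : IsCompact (frontier D) := Metric.isCompact_of_isClosed_isBounded isClosed_frontier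
    (hb.closure.subset frontier_subset_closure)
  choose! b L γ U hxU hU using fun x (hx : x ∈ frontier D) => hl.exists_isGraphChart hx
  obtain ⟨t, ht, hcov⟩ := hcomp.elim_nhds_subcover U fun x hx => (hU x hx).isOpen.mem_nhds (hxU x hx)
  refine ⟨t, inferInstance, fun i => U i, fun x hx => ?_, fun i => ⟨_, _, _, hU i (ht i i.2)⟩⟩
  obtain ⟨i, hi, hxi⟩ := Set.mem_iUnion₂.1 (hcov hx)
  exact Set.mem_iUnion.2 ⟨⟨i, hi⟩, hxi⟩

theorem surfaceMeasure_compl_frontier (D : Set E3) : surfaceMeasure D (frontier D)ᶜ = 0 := by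
  rw [surfaceMeasure, Measure.restrict_apply isClosed_frontier.measurableSet.compl]
  simp

theorem isFiniteMeasure_surfaceMeasure (hb : Bornology.IsBounded D) (hl : HasLipschitzBoundary D) :
    IsFiniteMeasure (surfaceMeasure D) := by
  obtain ⟨ι, _, U, hcov, hU⟩ := exists_finite_graphChart_cover hb hl
  refine ⟨?_⟩
  calc surfaceMeasure D Set.univ ≤ surfaceMeasure D ((frontier D)ᶜ ∪ ⋃ i, U i) :=
        measure_mono fun x _ => by
          by_cases hx : x ∈ frontier D
          · exact Or.inr (hcov hx)
          · exact Or.inl hx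
    _ ≤ surfaceMeasure D (frontier D)ᶜ + surfaceMeasure D (⋃ i, U i) := measure_union_le _ _
    _ ≤ 0 + ∑ i, surfaceMeasure D (U i) := by
        rw [surfaceMeasure_compl_frontier]
        gcongr
        exact measure_iUnion_fintype_le _ _
    _ < ⊤ := by
        rw [zero_add]
        refine ENNReal.sum_lt_top.2 fun i _ => ?_
        obtain ⟨b, L, γ, h⟩ := hU i
        exact h.surfaceMeasure_lt_top

theorem aemeasurable_normal (hb : Bornology.IsBounded D) (hl : HasLipschitzBoundary D) :
    AEMeasurable (normal D) (surfaceMeasure D) := by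
  obtain ⟨ι, _, U, hcov, hU⟩ := exists_finite_graphChart_cover hb hl
  have h1 : AEMeasurable (normal D) ((surfaceMeasure D).restrict (⋃ i, U i)) := by
    refine aemeasurable_iUnion_iff.2 fun i => ?_
    obtain ⟨b, L, γ, h⟩ := hU i
    exact h.aemeasurable_normal
  rwa [Measure.restrict_eq_self_of_ae_mem] at h1
  refine measure_mono_null (fun x hx hx' => hx (hcov hx')) (surfaceMeasure_compl_frontier D)

theorem integrable_inner_normal (hb : Bornology.IsBounded D) (hl : HasLipschitzBoundary D)
    {f : E3 → ℝ} (hf : Continuous f) (a : E3) :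
    Integrable (fun y => f y * ⟪normal D y, a⟫) (surfaceMeasure D) := by
  have := isFiniteMeasure_surfaceMeasure hb hl
  obtain ⟨C, hC⟩ := hb.isCompact_closure.exists_bound_of_continuousOn hf.continuousOn
  have hn : Measurable fun n : E3 => ⟪n, a⟫ := by fun_prop
  refine Integrable.of_bound (C := C * ‖a‖) (hf.aestronglyMeasurable.mul
    (hn.comp_aemeasurable (aemeasurable_normal hb hl)).aestronglyMeasurable) ?_
  have hae : ∀ᵐ y ∂surfaceMeasure D, y ∈ frontier D := surfaceMeasure_compl_frontier D
  filter_upwards [hae] with y hy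
  rw [norm_mul]
  refine mul_le_mul (hC y (frontier_subset_closure hy)) ?_ (norm_nonneg _)
    ((norm_nonneg _).trans (hC y (frontier_subset_closure hy)))
  refine (norm_inner_le_norm _ _).trans ?_
  exact mul_le_of_le_one_left (norm_nonneg _) (norm_normal_le D y)

/-- Both sides vanish: f is zero on ∂D, and the derivative of a compactly supported function has
integral zero. -/
theorem integral_fderiv_of_tsupport_subset (hD : IsOpen D) (hb : Bornology.IsBounded D)
    {f : E3 → ℝ} (hf : ContDiff ℝ 1 f) (hfD : tsupport f ⊆ D) (a : E3) :
    ∫ y in D, fderiv ℝ f y a = ∫ y, f y * ⟪normal D y, a⟫ ∂surfaceMeasure D := by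
  have hfc : HasCompactSupport f :=
    Metric.isCompact_of_isClosed_isBounded (isClosed_tsupport f) (hb.subset hfD)
  have h0 : ∀ y, y ∉ D → fderiv ℝ f y a = 0 := fun y hy => by
    rw [image_eq_zero_of_notMem_tsupport fun hy' => hy (hfD (tsupport_fderiv_subset ℝ hy'))]
    rfl
  have hae : ∀ᵐ y ∂surfaceMeasure D, f y * ⟪normal D y, a⟫ = 0 := by
    filter_upwards [show ∀ᵐ y ∂surfaceMeasure D, y ∈ frontier D from
      surfaceMeasure_compl_frontier D] with y hy
    rw [hD.frontier_eq] at hy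
    have hfy : f y = 0 := image_eq_zero_of_notMem_tsupport fun hy' => hy.2 (hfD hy')
    rw [hfy, zero_mul]
  rw [integral_eq_zero_of_ae hae, setIntegral_eq_integral_of_forall_compl_eq_zero h0]
  obtain ⟨C, hC⟩ := hf.lipschitzWith_of_hasCompactSupport hfc one_ne_zero
  rw [← integral_lineDeriv_eq_zero (μ := volume) hC hfc a]
  exact integral_congr_ae (ae_of_all _ fun y =>
    ((hf.differentiable one_ne_zero y).lineDeriv_eq_fderiv).symm)

/-- The divergence theorem on bounded open sets with Lipschitz boundary. -/
theorem integral_fderiv_eq_integral_normal (hD : IsOpen D) (hb : Bornology.IsBounded D)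
    (hl : HasLipschitzBoundary D) {f : E3 → ℝ} (hf : ContDiff ℝ 1 f) (a : E3) :
    ∫ y in D, fderiv ℝ f y a = ∫ y, f y * ⟪normal D y, a⟫ ∂surfaceMeasure D := by
  obtain ⟨ι, _, U, hcov, hU⟩ := exists_finite_graphChart_cover hb hl
  -- The index `none` stands for the interior piece D, so that V covers the closure.
  let V : Option ι → Set E3 := fun o => o.elim D U
  have hV : ∀ o, IsOpen (V o) := by
    rintro (_ | i)
    · exact hD
    · obtain ⟨b, L, γ, h⟩ := hU i
      exact h.isOpen
  have hVcov : closure D ⊆ ⋃ o, V o := by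
    intro x hx
    by_cases hxD : x ∈ D
    · exact Set.mem_iUnion.2 ⟨none, hxD⟩
    · have hxf : x ∈ frontier D := by rw [hD.frontier_eq]; exact ⟨hx, hxD⟩
      obtain ⟨i, hi⟩ := Set.mem_iUnion.1 (hcov hxf)
      exact Set.mem_iUnion.2 ⟨some i, hi⟩
  obtain ⟨ρ, hρ⟩ := SmoothPartitionOfUnity.exists_isSubordinate 𝓘(ℝ, E3) isClosed_closure V hV hVcov
  have hρ1 : ∀ y ∈ closure D, ∑ o, ρ o y = 1 := fun y hy => by
    rw [← finsum_eq_sum_of_fintype]; exact ρ.sum_eq_one hy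
  have hρd : ∀ o, ContDiff ℝ 1 (ρ o) := fun o =>
    (contMDiff_iff_contDiff.1 (ρ o).contMDiff).of_le (by norm_cast)
  have hg : ∀ o, ContDiff ℝ 1 fun y => ρ o y * f y := fun o => (hρd o).mul hf
  have hgV : ∀ o, tsupport (fun y => ρ o y * f y) ⊆ V o := fun o =>
    (tsupport_mul_subset_left).trans (hρ o)
  have hpiece : ∀ o, ∫ y in D, fderiv ℝ (fun y => ρ o y * f y) y a =
      ∫ y, ρ o y * f y * ⟪normal D y, a⟫ ∂surfaceMeasure D := by
    rintro (_ | i)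
    · exact integral_fderiv_of_tsupport_subset hD hb (hg none) (hgV none) a
    · obtain ⟨b, L, γ, h⟩ := hU i
      exact h.integral_fderiv hD (hg _) (hgV (some i)) a
  have hsum : ∀ y ∈ D, fderiv ℝ f y a = ∑ o, fderiv ℝ (fun y => ρ o y * f y) y a := by
    intro y hy
    have hev : f =ᶠ[𝓝 y] fun y => ∑ o, ρ o y * f y := by
      filter_upwards [hD.mem_nhds hy] with x hx
      rw [← Finset.sum_mul, hρ1 x (subset_closure hx), one_mul]
    rw [hev.fderiv_eq, fderiv_fun_sum fun o _ => (hg o).differentiable one_ne_zero y]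
    simp
  have hint : ∀ o, IntegrableOn (fun y => fderiv ℝ (fun y => ρ o y * f y) y a) D := fun o =>
    ((((hg o).continuous_fderiv one_ne_zero).clm_apply continuous_const).continuousOn.integrableOn_compact
      hb.isCompact_closure).mono_set subset_closure
  rw [setIntegral_congr_fun hD.measurableSet hsum, integral_finsetSum _ fun o _ => hint o]
  simp only [hpiece]
  rw [← integral_finsetSum _ fun o _ => integrable_inner_normal hb hl (hg o).continuous a]
  refine integral_congr_ae ?_
  filter_upwards [show ∀ᵐ y ∂surfaceMeasure D, y ∈ frontier D from
    surfaceMeasure_compl_frontier D] with y hy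
  rw [← Finset.sum_mul, ← Finset.sum_mul, hρ1 y (frontier_subset_closure hy), one_mul]

end PhysicalOptics
end

/-! ### Cross products, the amplitude and plane waves. -/

noncomputable section
namespace PhysicalOptics

open Filter Topology Module
open scoped ENNReal NNReal ComplexConjugate

section CrossProduct

variable {R : Type*} [CommRing R] (a b c : EuclideanSpace R (Fin 3)) (r : R)

theorem cross_apply_zero : cross a b 0 = a 1 * b 2 - a 2 * b 1 := by
  simp [cross, crossProduct]

theorem cross_apply_one : cross a b 1 = a 2 * b 0 - a 0 * b 2 := by
  simp [cross, crossProduct]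

theorem cross_apply_two : cross a b 2 = a 0 * b 1 - a 1 * b 0 := by
  simp [cross, crossProduct]

theorem add_cross : cross (a + b) c = cross a c + cross b c := by
  unfold cross
  rw [WithLp.ofLp_add, map_add, LinearMap.add_apply, WithLp.toLp_add]

theorem cross_add : cross a (b + c) = cross a b + cross a c := by
  unfold cross
  rw [WithLp.ofLp_add, map_add, WithLp.toLp_add]

theorem smul_cross : cross (r • a) b = r • cross a b := by
  unfold cross
  rw [WithLp.ofLp_smul, map_smul, LinearMap.smul_apply, WithLp.toLp_smul]

theorem cross_smul : cross a (r • b) = r • cross a b := by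
  unfold cross
  rw [WithLp.ofLp_smul, map_smul, WithLp.toLp_smul]

theorem neg_cross : cross (-a) b = -cross a b := by
  rw [← neg_one_smul R a, smul_cross, neg_one_smul]

theorem cross_neg : cross a (-b) = -cross a b := by
  rw [← neg_one_smul R b, cross_smul, neg_one_smul]

end CrossProduct

theorem toC_cross (a b : E3) : toC (cross a b) = cross (toC a) (toC b) := by
  ext i
  fin_cases i <;> simp [toC, cross_apply_zero, cross_apply_one, cross_apply_two]

theorem inner_eq_sum (a b : E3) : ⟪a, b⟫ = a 0 * b 0 + a 1 * b 1 + a 2 * b 2 := by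
  simp [PiLp.inner_apply, Fin.sum_univ_three, mul_comm]

/-- `x × (v × x) = |x|² v - (x · v) x`. -/
theorem cross_cross_self (x v : E3) : cross x (cross v x) = ⟪x, x⟫ • v - ⟪x, v⟫ • x := by
  rw [inner_eq_sum, inner_eq_sum]
  ext i
  fin_cases i <;>
    simp [cross_apply_zero, cross_apply_one, cross_apply_two] <;> ring

/-- `n × (d × p) = (n · p) d - (n · d) p`. -/
theorem cross_cross (n d p : E3) : cross n (cross d p) = ⟪n, p⟫ • d - ⟪n, d⟫ • p := by
  ext i
  fin_cases i <;>
    simp [cross_apply_zero, cross_apply_one, cross_apply_two, inner_eq_sum] <;> ring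

theorem inner_cross_left (a b : E3) : ⟪cross a b, a⟫ = 0 := by
  simp [cross_apply_zero, cross_apply_one, cross_apply_two, inner_eq_sum]; ring

theorem inner_cross_right (a b : E3) : ⟪cross a b, b⟫ = 0 := by
  simp [cross_apply_zero, cross_apply_one, cross_apply_two, inner_eq_sum]; ring

/-- The amplitude as a linear function of the normal vector: `n ↦ x × ([n × (d × p)] × x)`. -/
def amplitudeMap (x d p : E3) : E3 →ₗ[ℝ] E3 where
  toFun n := cross x (cross (cross n (cross d p)) x)
  map_add' m n := by simp only [add_cross, cross_add]
  map_smul' r n := by simp only [smul_cross, cross_smul, RingHom.id_apply]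

theorem amplitudeMap_apply (x d p n : E3) :
    amplitudeMap x d p n = cross x (cross (cross n (cross d p)) x) := rfl

theorem amplitudeMap_sub (x d p : E3) : amplitudeMap x d p (d - x) = amplitude x d p := rfl

/-- The vector x enters twice and d once. -/
theorem amplitudeMap_neg_neg (x d p n : E3) :
    amplitudeMap (-x) (-d) p n = -amplitudeMap x d p n := by
  simp only [amplitudeMap_apply, neg_cross, cross_neg, neg_neg]

/-- There is a direction that sees the amplitude, but not the contribution of grazing normals. -/
theorem exists_direction {d p x : E3} (hd : ‖d‖ = 1) (hx : ‖x‖ = 1) (hA : amplitude x d p ≠ 0) :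
    ∃ c, ⟪c, amplitude x d p⟫ ≠ 0 ∧ (¬ (cross d x ≠ 0 ∧ ⟪p, cross d x⟫ = 0) →
      ∀ n, ⟪n, d⟫ = 0 → ⟪c, amplitudeMap x d p n⟫ = 0) := by
  by_cases h : cross d x ≠ 0 ∧ ⟪p, cross d x⟫ = 0
  · exact ⟨amplitude x d p, inner_self_ne_zero.2 hA, fun h' => absurd h h'⟩
  have hgraz : ∀ n, ⟪n, d⟫ = 0 → amplitudeMap x d p n = ⟪n, p⟫ • cross x (cross d x) := by
    intro n hn
    rw [amplitudeMap_apply, cross_cross n d p, hn, zero_smul, sub_zero, smul_cross, cross_smul]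
  by_cases h0 : cross d x = 0
  -- Here d and x are parallel, so grazing normals contribute nothing at all.
  · refine ⟨amplitude x d p, inner_self_ne_zero.2 hA, fun _ n hn => ?_⟩
    have : cross x (0 : E3) = 0 := by simpa using cross_smul x 0 (0 : ℝ)
    rw [hgraz n hn, h0, this, smul_zero, inner_zero_right]
  · have hpne : ⟪p, cross d x⟫ ≠ 0 := fun hp => h ⟨h0, hp⟩
    have hxx : ⟪x, x⟫ = 1 := by rw [real_inner_self_eq_norm_sq, hx, one_pow]
    have hdd : ⟪d, d⟫ = 1 := by rw [real_inner_self_eq_norm_sq, hd, one_pow]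
    -- For n orthogonal to d, B(n) is a multiple of d - (x·d)x, which is orthogonal to d × x. On the
    -- other hand c·A = -(1 - d·x) p·(d × x), and d·x = 1 would force d = x.
    refine ⟨cross d x, ?_, fun _ n hn => ?_⟩
    · rw [← amplitudeMap_sub, amplitudeMap_apply, cross_cross_self, hxx, one_smul, cross_cross]
      simp only [inner_sub_right, inner_smul_right, inner_cross_left, inner_cross_right,
        mul_zero, zero_sub, sub_zero, inner_sub_left, hdd]
      rw [neg_ne_zero, real_inner_comm p]
      refine mul_ne_zero (fun h1 => ?_) hpne
      have hxd : d = x := by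
        rw [← sub_eq_zero, ← inner_self_eq_zero (𝕜 := ℝ), inner_sub_left, inner_sub_right,
          inner_sub_right, hdd, hxx, real_inner_comm x d]
        linarith
      refine h0 ?_
      rw [hxd]
      ext i
      fin_cases i <;> simp [cross_apply_zero, cross_apply_one, cross_apply_two] <;> ring
    · rw [hgraz n hn, cross_cross_self, inner_smul_right, inner_sub_right, inner_smul_right,
        inner_smul_right, inner_cross_left, inner_cross_right]
      simp

/-- The plane wave `e^{ik w·y}`. -/
def planeWave (w : E3) (k : ℝ) (y : E3) : ℂ := Complex.exp (Complex.I * k * ⟪w, y⟫)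

theorem planeWave_eq (w : E3) (k : ℝ) (y : E3) :
    planeWave w k y = (Real.cos (k * ⟪w, y⟫) : ℂ) + (Real.sin (k * ⟪w, y⟫) : ℂ) * Complex.I := by
  rw [planeWave, Complex.ofReal_cos, Complex.ofReal_sin, ← Complex.exp_mul_I]
  congr 1
  push_cast
  ring

theorem continuous_planeWave (w : E3) (k : ℝ) : Continuous (planeWave w k) := by
  unfold planeWave; fun_prop

theorem norm_planeWave (w : E3) (k : ℝ) (y : E3) : ‖planeWave w k y‖ = 1 := by
  have : planeWave w k y = Complex.exp ((k * ⟪w, y⟫ : ℝ) * Complex.I) := by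
    rw [planeWave]; congr 1; push_cast; ring
  rw [this, Complex.norm_exp_ofReal_mul_I]

theorem conj_planeWave (w : E3) (k : ℝ) (y : E3) :
    conj (planeWave w k y) = planeWave (-w) k y := by
  simp only [planeWave_eq, inner_neg_left, mul_neg, Real.cos_neg, Real.sin_neg, map_add, map_mul,
    Complex.conj_ofReal, Complex.conj_I, Complex.ofReal_neg, neg_mul]

/-- The divergence theorem for plane waves. -/
theorem integral_planeWave_mul_inner_normal {D : Set E3} (hD : IsOpen D)
    (hb : Bornology.IsBounded D) (hl : HasLipschitzBoundary D) (w a : E3) (k : ℝ) :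
    ∫ y, planeWave w k y * (⟪normal D y, a⟫ : ℝ) ∂surfaceMeasure D =
      Complex.I * k * (⟪w, a⟫ : ℝ) * ∫ y in D, planeWave w k y := by
  have hwd : ContDiff ℝ 1 fun y : E3 => k * ⟪w, y⟫ :=
    contDiff_const.mul (contDiff_const.inner ℝ contDiff_id)
  have hcd : ContDiff ℝ 1 fun y : E3 => Real.cos (k * ⟪w, y⟫) := hwd.cos
  have hsd : ContDiff ℝ 1 fun y : E3 => Real.sin (k * ⟪w, y⟫) := hwd.sin
  have hi : ∀ y : E3, HasFDerivAt (fun y : E3 => k * ⟪w, y⟫) (k • innerSL ℝ w) y := fun y =>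
    ((innerSL ℝ w).hasFDerivAt).const_mul k
  have h1 := integral_fderiv_eq_integral_normal hD hb hl hcd a
  have h2 := integral_fderiv_eq_integral_normal hD hb hl hsd a
  have e1 : ∀ y : E3, fderiv ℝ (fun y : E3 => Real.cos (k * ⟪w, y⟫)) y a =
      -(k * ⟪w, a⟫) * Real.sin (k * ⟪w, y⟫) := fun y => by
    rw [(hi y).cos.fderiv]; simp; ring
  have e2 : ∀ y : E3, fderiv ℝ (fun y : E3 => Real.sin (k * ⟪w, y⟫)) y a =
      (k * ⟪w, a⟫) * Real.cos (k * ⟪w, y⟫) := fun y => by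
    rw [(hi y).sin.fderiv]; simp; ring
  simp only [e1, e2, integral_const_mul] at h1 h2
  have hint : ∀ f : E3 → ℝ, Continuous f →
      Integrable (fun y => (f y : ℂ)) (volume.restrict D) := fun f hf =>
    (((hf.continuousOn.integrableOn_compact hb.isCompact_closure).mono_set
      subset_closure)).ofReal
  have hs1 : ∫ y, planeWave w k y * (⟪normal D y, a⟫ : ℝ) ∂surfaceMeasure D =
      ((∫ y, Real.cos (k * ⟪w, y⟫) * ⟪normal D y, a⟫ ∂surfaceMeasure D : ℝ) : ℂ) +
      ((∫ y, Real.sin (k * ⟪w, y⟫) * ⟪normal D y, a⟫ ∂surfaceMeasure D : ℝ) : ℂ) * Complex.I := by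
    rw [← integral_complex_ofReal, ← integral_complex_ofReal, ← integral_mul_const,
      ← integral_add (integrable_inner_normal hb hl hcd.continuous a).ofReal
        ((integrable_inner_normal hb hl hsd.continuous a).ofReal.mul_const _)]
    congr 1
    ext y
    rw [planeWave_eq]
    push_cast
    ring
  have hs2 : ∫ y in D, planeWave w k y = ((∫ y in D, Real.cos (k * ⟪w, y⟫) : ℝ) : ℂ) +
      ((∫ y in D, Real.sin (k * ⟪w, y⟫) : ℝ) : ℂ) * Complex.I := by
    rw [← integral_complex_ofReal, ← integral_complex_ofReal, ← integral_mul_const,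
      ← integral_add (hint _ hcd.continuous) ((hint _ hsd.continuous).mul_const _)]
    simp only [planeWave_eq]
  rw [hs1, hs2, ← h1, ← h2]
  push_cast
  linear_combination (-(k : ℂ) * (⟪w, a⟫ : ℝ) * ((∫ y in D, Real.sin (k * ⟪w, y⟫) : ℝ) : ℂ)) *
    Complex.I_sq

end PhysicalOptics
end

/-! ### From far field patterns to the Fourier transform of the obstacle. -/

noncomputable section
namespace PhysicalOptics

open Filter Topology Module
open scoped ENNReal NNReal ComplexConjugate

/-- The linear functional `v ↦ c · (x × v)` on `ℂ³`. -/
def crossFunctional (c x : E3) : C3 →L[ℂ] ℂ :=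
  LinearMap.toContinuousLinearMap
    { toFun := fun v => ∑ j, (c j : ℂ) * cross (toC x) v j
      map_add' := fun v w => by simp [cross_add, mul_add, Finset.sum_add_distrib]
      map_smul' := fun r v => by
        simp only [cross_smul, PiLp.smul_apply, smul_eq_mul, RingHom.id_apply, Finset.mul_sum]
        exact Finset.sum_congr rfl fun j _ => by ring }

theorem crossFunctional_apply (c x : E3) (v : C3) :
    crossFunctional c x v = ∑ j, (c j : ℂ) * cross (toC x) v j := rfl

theorem crossFunctional_toC (c x v : E3) :
    crossFunctional c x (toC v) = (⟪c, cross x v⟫ : ℝ) := by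
  rw [crossFunctional_apply, ← toC_cross, inner_eq_sum, Fin.sum_univ_three]
  simp [toC]

theorem continuous_toC : Continuous toC := by
  unfold toC; fun_prop

theorem toC_smul_smul (s : ℂ) (v w : E3) :
    cross (toC v) (s • toC w) = s • toC (cross v w) := by
  rw [cross_smul, toC_cross]

/-- The weight of the plane wave on the illuminated part. -/
def illumination (d w : E3) (k : ℝ) (n y : E3) : ℂ :=
  if ⟪n, d⟫ < 0 then 2 * planeWave w k y else 0

theorem farField_integrand (D : Set E3) (x d p : E3) (k : ℝ) (y : E3) :
    Complex.exp (-(Complex.I * k * ⟪x, y⟫)) • cross (poField D d p k y) (toC x) =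
      illumination d (d - x) k (normal D y) y •
        toC (cross (cross (normal D y) (cross d p)) x) := by
  unfold poField illumination
  split_ifs with h
  · rw [incidentH, toC_smul_smul, smul_cross, smul_cross, ← toC_cross, smul_smul, smul_smul,
      planeWave]
    congr 1
    rw [mul_comm _ (2 : ℂ), mul_assoc, ← Complex.exp_add]
    congr 2
    rw [inner_sub_left, real_inner_comm y d]
    push_cast
    ring
  · rw [zero_smul, ← zero_smul ℂ (0 : C3), smul_cross, zero_smul, smul_zero, zero_smul]

theorem measurable_illumination (d w : E3) (k : ℝ) :
    Measurable fun q : E3 × E3 => illumination d w k q.1 q.2 := by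
  unfold illumination
  refine Measurable.ite (measurableSet_lt (by fun_prop) measurable_const) ?_ measurable_const
  exact ((continuous_planeWave w k).measurable.comp measurable_snd).const_mul 2

theorem norm_illumination_le (d w : E3) (k : ℝ) (n y : E3) : ‖illumination d w k n y‖ ≤ 2 := by
  unfold illumination
  split_ifs
  · simp [norm_planeWave]
  · simp

variable {D : Set E3}

theorem integrable_illumination_smul {F : Type*} [NormedAddCommGroup F] [NormedSpace ℂ F]
    [SecondCountableTopology F] [MeasurableSpace F] [BorelSpace F] (hb : Bornology.IsBounded D)
    (hl : HasLipschitzBoundary D) (d w : E3) (k : ℝ) {T : E3 → F} (hT : Continuous T) :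
    Integrable (fun y => illumination d w k (normal D y) y • T (normal D y))
      (surfaceMeasure D) := by
  have := isFiniteMeasure_surfaceMeasure hb hl
  have hn := aemeasurable_normal hb hl
  obtain ⟨C, hC⟩ := (isCompact_closedBall (0 : E3) 1).exists_bound_of_continuousOn hT.continuousOn
  refine Integrable.of_bound (C := 2 * C) ?_ (ae_of_all _ fun y => ?_)
  · exact (((measurable_illumination d w k).comp_aemeasurable
      (hn.prodMk aemeasurable_id)).aestronglyMeasurable).smul
      (hT.measurable.comp_aemeasurable hn).aestronglyMeasurable
  · rw [norm_smul]
    exact mul_le_mul (norm_illumination_le _ _ _ _ _)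
      (hC _ (mem_closedBall_zero_iff.2 (norm_normal_le D y))) (norm_nonneg _) zero_le_two

/-- A component of the far field pattern as a scalar surface integral. -/
theorem sum_mul_farField (hb : Bornology.IsBounded D) (hl : HasLipschitzBoundary D)
    (c x d p : E3) (k : ℝ) :
    ∑ j, (c j : ℂ) * farField D x d p k j = Complex.I * k *
      ∫ y, illumination d (d - x) k (normal D y) y *
        (⟪c, amplitudeMap x d p (normal D y)⟫ : ℝ) ∂surfaceMeasure D := by
  have hT : Continuous fun n : E3 => toC (cross (cross n (cross d p)) x) := by
    have h : Continuous fun n : E3 => cross (cross n (cross d p)) x :=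
      (LinearMap.toContinuousLinearMap (⟨⟨fun n => cross (cross n (cross d p)) x,
        fun m n => by simp only [add_cross]⟩, fun r n => by simp only [smul_cross, RingHom.id_apply]⟩ :
          E3 →ₗ[ℝ] E3)).continuous
    exact continuous_toC.comp h
  have hint := integrable_illumination_smul hb hl d (d - x) k hT
  have h1 := (crossFunctional c x).integral_comp_comm hint
  simp only [map_smul, crossFunctional_toC, smul_eq_mul, ← amplitudeMap_apply] at h1
  rw [h1, crossFunctional_apply, farField]
  simp only [farField_integrand, PiLp.smul_apply, smul_eq_mul, Finset.mul_sum]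
  exact Finset.sum_congr rfl fun j _ => by ring

theorem continuous_inner_amplitudeMap (c x d p : E3) :
    Continuous fun n => ((⟪c, amplitudeMap x d p n⟫ : ℝ) : ℂ) := by
  have := (amplitudeMap x d p).continuous_of_finiteDimensional
  fun_prop

/-- The two far field patterns together determine the Fourier transform of the obstacle. -/
theorem sum_mul_farField_add_conj (hD : IsOpen D) (hb : Bornology.IsBounded D)
    (hl : HasLipschitzBoundary D) {c x d p : E3} (k : ℝ)
    (hgraz : ∀ᵐ y ∂surfaceMeasure D, ⟪normal D y, d⟫ = 0 →
      ⟪c, amplitudeMap x d p (normal D y)⟫ = 0) :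
    ∑ j, (c j : ℂ) * farField D x d p k j +
        conj (∑ j, (c j : ℂ) * farField D (-x) (-d) p k j) =
      -2 * k ^ 2 * (⟪c, amplitude x d p⟫ : ℝ) * ∫ y in D, planeWave (d - x) k y := by
  set B := amplitudeMap x d p with hB
  have hadj : ∀ n, ⟪c, B n⟫ = ⟪n, LinearMap.adjoint B c⟫ := fun n => by
    rw [LinearMap.adjoint_inner_right, real_inner_comm]
  have hdiv := integral_planeWave_mul_inner_normal hD hb hl (d - x) (LinearMap.adjoint B c) k
  simp only [← hadj] at hdiv
  have i1 := integrable_illumination_smul hb hl d (d - x) k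
    (continuous_inner_amplitudeMap c x d p)
  have i2 := integrable_illumination_smul hb hl (-d) (d - x) k
    (continuous_inner_amplitudeMap c x d p)
  simp only [smul_eq_mul] at i1 i2
  have hconj : ∀ y, conj (illumination (-d) (-d - -x) k (normal D y) y *
      (⟪c, amplitudeMap (-x) (-d) p (normal D y)⟫ : ℝ)) =
      -(illumination (-d) (d - x) k (normal D y) y * (⟪c, B (normal D y)⟫ : ℝ)) := by
    intro y
    rw [map_mul, Complex.conj_ofReal, amplitudeMap_neg_neg, inner_neg_right, Complex.ofReal_neg,
      mul_neg]
    congr 2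
    unfold illumination
    split_ifs
    · rw [map_mul, conj_planeWave, Complex.conj_ofNat]
      congr 2
      abel
    · simp
  rw [sum_mul_farField hb hl, sum_mul_farField hb hl, map_mul, ← integral_conj]
  simp only [hconj, integral_neg]
  have hsum : (∫ y, illumination d (d - x) k (normal D y) y *
        (⟪c, B (normal D y)⟫ : ℝ) ∂surfaceMeasure D) +
      ∫ y, illumination (-d) (d - x) k (normal D y) y *
        (⟪c, B (normal D y)⟫ : ℝ) ∂surfaceMeasure D =
      2 * ∫ y, planeWave (d - x) k y * (⟪c, B (normal D y)⟫ : ℝ) ∂surfaceMeasure D := by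
    rw [← integral_add i1 i2, ← integral_const_mul]
    refine integral_congr_ae ?_
    filter_upwards [hgraz] with y hy
    unfold illumination
    rw [inner_neg_right]
    -- Off the grazing set exactly one of the two incident directions illuminates y; on it the
    -- factor c·B(ν) is zero.
    rcases lt_trichotomy ⟪normal D y, d⟫ 0 with h | h | h
    · rw [if_pos h, if_neg (by linarith)]; ring
    · rw [hy h]; simp
    · rw [if_neg (by linarith), if_pos (by linarith)]; ring
  rw [hdiv, show B (d - x) = amplitude x d p from amplitudeMap_sub x d p] at hsum
  simp only [map_mul, Complex.conj_I, Complex.conj_ofReal]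
  linear_combination (Complex.I * k) * hsum +
    (2 * k ^ 2 * (⟪c, amplitude x d p⟫ : ℝ) * ∫ y in D, planeWave (d - x) k y) * Complex.I_sq

theorem grazing_condition {d p x c : E3}
    (hc : ¬ (cross d x ≠ 0 ∧ ⟪p, cross d x⟫ = 0) →
      ∀ n, ⟪n, d⟫ = 0 → ⟪c, amplitudeMap x d p n⟫ = 0)
    (hg : cross d x ≠ 0 → ⟪p, cross d x⟫ = 0 → GrazingNull D d) :
    ∀ᵐ y ∂surfaceMeasure D, ⟪normal D y, d⟫ = 0 →
      ⟪c, amplitudeMap x d p (normal D y)⟫ = 0 := by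
  by_cases h : cross d x ≠ 0 ∧ ⟪p, cross d x⟫ = 0
  · have h0 : ∀ᵐ y ∂surfaceMeasure D, ¬ ⟪normal D y, d⟫ = 0 := by
      rw [ae_iff]
      simp only [not_not]
      exact hg h.1 h.2
    filter_upwards [h0] with y hy hy' using absurd hy' hy
  · exact ae_of_all _ fun y => hc h _

/-! ### Recovering the strip from Fourier data. -/

open ProbabilityTheory in
/-- The Fourier transforms of bounded sets in one direction, known for an interval of wave numbers,
determine the distribution of volume in that direction. -/
theorem map_inner_eq_of_integral_planeWave_eq {D₁ D₂ : Set E3} (hb₁ : Bornology.IsBounded D₁)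
    (hb₂ : Bornology.IsBounded D₂) (w : E3) {s t : ℝ} (hst : s < t)
    (h : ∀ k ∈ Set.Icc s t, ∫ y in D₁, planeWave w k y = ∫ y in D₂, planeWave w k y) :
    (volume.restrict D₁).map (fun y => ⟪w, y⟫) = (volume.restrict D₂).map fun y => ⟪w, y⟫ := by
  -- On a bounded set all exponential moments are finite, so the complex moment generating function
  -- is entire.
  have hset : ∀ D : Set E3, Bornology.IsBounded D →
      integrableExpSet (fun y => ⟪w, y⟫) (volume.restrict D) = Set.univ := by
    refine fun D hD => Set.eq_univ_of_forall fun r => ?_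
    have hc : Continuous fun y : E3 => Real.exp (r * ⟪w, y⟫) := by fun_prop
    exact (hc.continuousOn.integrableOn_compact hD.isCompact_closure).mono_set subset_closure
  have hfin : ∀ D : Set E3, Bornology.IsBounded D → IsFiniteMeasure (volume.restrict D) :=
    fun D hD => ⟨by rw [Measure.restrict_apply_univ]; exact hD.measure_lt_top⟩
  have := hfin D₁ hb₁
  have := hfin D₂ hb₂
  have han : ∀ D : Set E3, Bornology.IsBounded D →
      AnalyticOnNhd ℂ (complexMGF (fun y => ⟪w, y⟫) (volume.restrict D)) Set.univ := by
    intro D hD z _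
    refine analyticAt_complexMGF ?_
    rw [hset D hD, interior_univ]
    exact Set.mem_univ _
  have hm : Measurable fun y : E3 => ⟪w, y⟫ := by fun_prop
  refine Measure.ext_of_complexMGF_eq hm.aemeasurable hm.aemeasurable ?_
  refine (han D₁ hb₁).eq_of_frequently_eq (han D₂ hb₂) (z₀ := Complex.I * s) ?_
  -- The data live on the segment from is to it, which accumulates at is; the identity theorem then
  -- applies.
  have ht : Tendsto (fun k : ℝ => Complex.I * k) (𝓝[>] s) (𝓝[≠] (Complex.I * s)) := by
    refine tendsto_nhdsWithin_iff.2 ⟨?_, ?_⟩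
    · have : Continuous fun k : ℝ => Complex.I * k := by fun_prop
      exact (this.tendsto s).mono_left nhdsWithin_le_nhds
    · filter_upwards [self_mem_nhdsWithin] with k hk heq
      rw [Set.mem_singleton_iff, mul_right_inj' Complex.I_ne_zero, Complex.ofReal_inj] at heq
      exact (ne_of_gt hk) heq
  refine ht.frequently (Eventually.frequently ?_)
  filter_upwards [Ioc_mem_nhdsGT hst] with k hk
  exact h k ⟨hk.1.le, hk.2⟩

theorem isBounded_image_inner (hb : Bornology.IsBounded D) (θ : E3) :
    Bornology.IsBounded ((fun z : E3 => ⟪z, θ⟫) '' D) := by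
  have hc : Continuous fun z : E3 => ⟪z, θ⟫ := by fun_prop
  exact (hb.isCompact_closure.image hc).isBounded.subset (Set.image_mono subset_closure)

/-- If the distributions of volume agree, then every open set that is hit by one of the projections
is hit by the other. -/
theorem exists_mem_of_map_inner_eq {D₁ D₂ : Set E3} (hD₁ : IsOpen D₁) {θ : E3}
    (h : (volume.restrict D₁).map (fun y => ⟪y, θ⟫) = (volume.restrict D₂).map fun y => ⟪y, θ⟫)
    {V : Set ℝ} (hV : IsOpen V) {z : E3} (hz : z ∈ D₁) (hzV : ⟪z, θ⟫ ∈ V) :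
    ∃ z' ∈ D₂, ⟪z', θ⟫ ∈ V := by
  by_contra! hne
  have hc : Continuous fun y : E3 => ⟪y, θ⟫ := by fun_prop
  have h1 := congrArg (fun μ : Measure ℝ => μ V) h
  simp only [Measure.map_apply hc.measurable hV.measurableSet,
    Measure.restrict_apply (hc.measurable hV.measurableSet)] at h1
  have h2 : (fun y => ⟪y, θ⟫) ⁻¹' V ∩ D₂ = ∅ := by
    ext y; exact ⟨fun hy => hne y hy.2 hy.1, fun hy => hy.elim⟩
  rw [h2, measure_empty] at h1
  exact (((hV.preimage hc).inter hD₁).measure_pos volume ⟨z, hzV, hz⟩).ne' h1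

theorem strip_eq_of_map_inner_eq {D₁ D₂ : Set E3} (hD₁ : IsOpen D₁) (hD₂ : IsOpen D₂)
    (hn₁ : D₁.Nonempty) (hn₂ : D₂.Nonempty) (hb₁ : Bornology.IsBounded D₁)
    (hb₂ : Bornology.IsBounded D₂) {θ : E3}
    (h : (volume.restrict D₁).map (fun y => ⟪y, θ⟫) = (volume.restrict D₂).map fun y => ⟪y, θ⟫) :
    strip D₁ θ = strip D₂ θ := by
  -- A one-sided comparison of the endpoints, to be used in both directions.
  have key : ∀ {D₁ D₂ : Set E3}, IsOpen D₁ → D₁.Nonempty → Bornology.IsBounded D₂ →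
      (volume.restrict D₁).map (fun y => ⟪y, θ⟫) = (volume.restrict D₂).map (fun y => ⟪y, θ⟫) →
      sInf ((fun z : E3 => ⟪z, θ⟫) '' D₂) ≤ sInf ((fun z : E3 => ⟪z, θ⟫) '' D₁) ∧
        sSup ((fun z : E3 => ⟪z, θ⟫) '' D₁) ≤ sSup ((fun z : E3 => ⟪z, θ⟫) '' D₂) := by
    intro D₁ D₂ hD hn hb h
    have hbd := isBounded_image_inner hb θ
    constructor
    · refine le_csInf (hn.image _) ?_
      rintro _ ⟨z, hz, rfl⟩
      refine le_of_forall_gt_imp_ge_of_dense fun r hr => ?_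
      obtain ⟨z', hz', hlt⟩ := exists_mem_of_map_inner_eq hD h isOpen_Iio hz hr
      exact (csInf_le hbd.bddBelow ⟨z', hz', rfl⟩).trans (le_of_lt hlt)
    · refine csSup_le (hn.image _) ?_
      rintro _ ⟨z, hz, rfl⟩
      refine le_of_forall_lt_imp_le_of_dense fun r hr => ?_
      obtain ⟨z', hz', hlt⟩ := exists_mem_of_map_inner_eq hD h isOpen_Ioi hz hr
      exact (le_of_lt hlt).trans (le_csSup hbd.bddAbove ⟨z', hz', rfl⟩)
  have k1 := key hD₁ hn₁ hb₂ h
  have k2 := key hD₂ hn₂ hb₁ h.symm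
  unfold strip
  rw [le_antisymm k1.1 k2.1, le_antisymm k1.2 k2.2]

end PhysicalOptics
end

/-! ### Conclusion. -/

theorem theorem4p1 (kmin kmax : ℝ) (hkmin : 0 < kmin) (hk : kmin < kmax)
    (d p x : E3) (hd : ‖d‖ = 1) (hp : ‖p‖ = 1) (hx : ‖x‖ = 1)
    (hA : amplitude x d p ≠ 0)
    (D₁ D₂ : Set E3) (hD₁ : IsObstacle D₁) (hD₂ : IsObstacle D₂)
    (hgrazing : cross d x ≠ 0 → ⟪p, cross d x⟫ = 0 → GrazingNull D₁ d ∧ GrazingNull D₂ d)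
    (hdata : ∀ k ∈ Set.Icc kmin kmax, farField D₁ x d p k = farField D₂ x d p k)
    (hdata' : ∀ k ∈ Set.Icc kmin kmax,
      farField D₁ (-x) (-d) p k = farField D₂ (-x) (-d) p k) :
    strip D₁ (stripNormal x d) = strip D₂ (stripNormal x d) := by
  obtain ⟨c, hcA, hc⟩ := exists_direction hd hx hA
  have hplane : ∀ k ∈ Set.Icc kmin kmax,
      ∫ y in D₁, planeWave (d - x) k y = ∫ y in D₂, planeWave (d - x) k y := by
    intro k hkI
    have h1 := sum_mul_farField_add_conj hD₁.isOpen hD₁.isBounded hD₁.lipschitz k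
      (grazing_condition hc fun h h' => (hgrazing h h').1)
    have h2 := sum_mul_farField_add_conj hD₂.isOpen hD₂.isBounded hD₂.lipschitz k
      (grazing_condition hc fun h h' => (hgrazing h h').2)
    rw [hdata k hkI, hdata' k hkI, h2] at h1
    -- The common factor -2k²(c·A) can be cancelled, because k ≥ kmin > 0.
    have hk0 : (k : ℂ) ≠ 0 := Complex.ofReal_ne_zero.2 (hkmin.trans_le hkI.1).ne'
    have hc0 : ((⟪c, amplitude x d p⟫ : ℝ) : ℂ) ≠ 0 := Complex.ofReal_ne_zero.2 hcA
    exact (mul_left_cancel₀ (mul_ne_zero (mul_ne_zero (by norm_num) (pow_ne_zero 2 hk0)) hc0)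
      h1).symm
  have hmap := map_inner_eq_of_integral_planeWave_eq hD₁.isBounded hD₂.isBounded (d - x) hk hplane
  refine strip_eq_of_map_inner_eq hD₁.isOpen hD₂.isOpen hD₁.isConnected.nonempty
    hD₂.isConnected.nonempty hD₁.isBounded hD₂.isBounded ?_
  -- The projection along φ is a rescaling of y ↦ w·y, so equality of image measures carries over.
  have hcomp : (fun y : E3 => ⟪y, stripNormal x d⟫) =
      (fun r : ℝ => ‖d - x‖⁻¹ * r) ∘ fun y => ⟪d - x, y⟫ := by
    ext y
    simp [stripNormal, inner_smul_right, real_inner_comm (d - x) y]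
  have hm : Measurable fun y : E3 => ⟪d - x, y⟫ := by fun_prop
  rw [hcomp, ← Measure.map_map (by fun_prop) hm, ← Measure.map_map (by fun_prop) hm, hmap]
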